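/- **Setting.** Let $\mathcal A\subset\mathbb R^d$ be a finite nonempty set of $K$ actions that spans $\mathbb R^d$. An oblivious environment fixes beforehand vectors $y_1,y_2,\dots\in\mathbb R^d$ such that $\langle x,y_t\rangle\in[m,M]$ for all $t\ge 1$ and $x\in\mathcal A$, where $m\le 0\le M$ are unknown to the player. At each round $t$ the player draws $X_t\in\mathcal A$ from a distribution $p_t$ that depends only on the past actions and their payoffs, and observes only the payoff $\langle X_t,y_t\rangle$. The expected regret is $$R_T(y_{1:T})=\max_{x\in\mathcal A}\sum_{t=1}^T\langle x,y_t\rangle-\mathbb E\Bigl[\sum_{t=1}^T\langle X_t,y_t\rangle\Bigr].$$ For a probability distribution $p$ on $\mathcal A$ put $M(p)=\sum_{x\in\mathcal A}p(x)\,xx^{\top}$. A *Kiefer–Wolfowitz design* is a probability distribution $\pi$ on $\mathcal A$ such that $M(\pi)$ is invertible and $\max_{x\in\mathcal A}x^\top M(\pi)^{-1}x=d$. **Algorithm** (AdaHedge for adversarial linear bandits, with exploration distribution $\pi$ and exploration rates $\gamma_t\in[0,1]$). Start with $\eta_1=+\infty$ and $q_1$ uniform on $\mathcal A$. At each round $t\ge1$,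 draw $X_t\sim p_t=(1-\gamma_t)q_t+\gamma_t\pi$, observe $\langle X_t,y_t\rangle$, and compute $\widehat y_t=M(p_t)^{-1}X_t\langle X_t,y_t\rangle$ and the mixability gap $$\delta_t=-\sum_{x\in\mathcal A}q_t(x)\langle x,\widehat y_t\rangle+\frac1{\eta_t}\log\sum_{x\in\mathcal A}q_t(x)e^{\eta_t\langle x,\widehat y_t\rangle}$$ (with the last term replaced by $\max_{x\in\mathcal A}\langle x,\widehat y_t\rangle$ if $\eta_t=+\infty$); then set $\eta_{t+1}=\bigl(\sum_{s\le t}\delta_s\bigr)^{-1}\ln K$ (equal to $+\infty$ if $\sum_{s\le t}\delta_s=0$) and $$q_{t+1}(a)=\frac{\exp\bigl(\eta_{t+1}\sum_{s\le t}\langle a,\widehat y_s\rangle\bigr)}{\sum_{x\in\mathcal A}\exp\bigl(\eta_{t+1}\sum_{s\le t}\langle x,\widehat y_s\rangle\bigr)}$$ (if $\eta_{t+1}=+\infty$: the uniform distribution on the maximizers of $a\mapsto\sum_{s\le t}\langle a,\widehat y_s\rangle$). **Theorem.** A Kiefer–Wolfowitz design on $\mathcal A$ exists. For every such design $\pi$,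 the algorithm above run with $\pi$ and the exploration rates $$\gamma_t=\min\Bigl\{\tfrac12,\ \sqrt{2.5\,d\,(\ln K)\,/\,t}\Bigr\}$$ satisfies, for all $m\le 0\le M$, all sequences $y_1,y_2,\dots$ as above, and all $T$, $$R_T(y_{1:T})\le 12(M-m)\sqrt{dT\ln K}+18(M-m)\,d\ln K .$$ -/

import Mathlib

open scoped Matrix

noncomputable section

namespace LinearBandit

/-! ### Bandit protocol against an oblivious environment

Rounds `1, 2, …` are indexed by `0, 1, …`: the index `t` stands for round `t + 1`. -/

/-- A randomized bandit strategy: after `t` rounds it has seen its own actions and the payoffs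
of these actions (and nothing else), and outputs the distribution of its next action. -/
def Strategy (α : Type*) : Type _ := (t : ℕ) → (Fin t → α × ℝ) → PMF α

/-- The law of the first `T` actions of a strategy, when action `a` yields the payoff `r t a`
at time `t`: given the past actions, the next one is drawn from the distribution output by the
strategy. -/
def actionLaw {α : Type*} (σ : Strategy α) (r : ℕ → α → ℝ) : (T : ℕ) → PMF (Fin T → α)
  | 0 => PMF.pure Fin.elim0
  | T + 1 => (actionLaw σ r T).bind fun X =>
      (σ T fun s => (X s, r s (X s))).map fun a => (Fin.snoc X a : Fin (T + 1) → α)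

/-- The expected regret
`max_x ∑_{t ≤ T} ⟨x, y_t⟩ - 𝔼 [∑_{t ≤ T} ⟨X_t, y_t⟩]` of a strategy over the finite action
set `A ⊆ ℝ^d`, against the sequence `y`. -/
def regret {d : ℕ} {A : Finset (Fin d → ℝ)} (σ : Strategy A) (y : ℕ → Fin d → ℝ) (T : ℕ) : ℝ :=
  (⨆ x : A, ∑ t : Fin T, (x : Fin d → ℝ) ⬝ᵥ y t) -
    ∫ X, ∑ t : Fin T, (X t : Fin d → ℝ) ⬝ᵥ y t
      ∂(actionLaw σ (fun t (x : A) => (x : Fin d → ℝ) ⬝ᵥ y t) T).toMeasure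

/-- The probability distribution with the given weights. -/
def toPMF {α : Type*} [Fintype α] (p : stdSimplex ℝ α) : PMF α :=
  PMF.ofFintype (fun a => ENNReal.ofReal (p.1 a)) (by
    rw [← ENNReal.ofReal_sum_of_nonneg fun a _ => p.2.1 a, p.2.2, ENNReal.ofReal_one])

/-! ### Exponential weights with the AdaHedge learning rates -/

/-- Exponential weights with learning rate `η ∈ (0, +∞]` for the cumulative payoffs `S`.
For `η = +∞` this is the limit of the formula as `η → +∞`, namely the uniform distribution over
the maximizers of `S` (in particular the uniform distribution over all actions if `S` is
constant). -/
def expWeights {α : Type*} [Fintype α] (η : WithTop ℝ) (S : α → ℝ) (a : α) : ℝ :=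
  open Classical in
  match η with
  | ⊤ => if ∀ b, S b ≤ S a then ((Finset.univ.filter fun c => ∀ b, S b ≤ S c).card : ℝ)⁻¹ else 0
  | (e : ℝ) => Real.exp (e * S a) / ∑ x, Real.exp (e * S x)

/-- The mixability gap of the distribution `q` for the payoffs `z`, at learning rate `η`. -/
def mixabilityGap {α : Type*} [Fintype α] (η : WithTop ℝ) (q z : α → ℝ) : ℝ :=
  match η with
  | ⊤ => -(∑ x, q x * z x) + ⨆ x, z x
  | (e : ℝ) => -(∑ x, q x * z x) + 1 / e * Real.log (∑ x, q x * Real.exp (e * z x))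

theorem expWeights_mem {α : Type*} [Fintype α] [Nonempty α] (η : WithTop ℝ) (S : α → ℝ) :
    expWeights η S ∈ stdSimplex ℝ α := by
  classical
  induction η using WithTop.recTopCoe with
  | top =>
    refine ⟨fun a => ?_, ?_⟩
    · simp only [expWeights]
      split_ifs <;> positivity
    · obtain ⟨a, ha⟩ := Finite.exists_max S
      have h : (Finset.univ.filter fun c => ∀ b, S b ≤ S c).card ≠ 0 :=
        Finset.card_ne_zero_of_mem (a := a) (by simpa using ha)
      simp only [expWeights, ← Finset.sum_filter, Finset.sum_const, nsmul_eq_mul]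
      convert mul_inv_cancel₀ (Nat.cast_ne_zero (R := ℝ).2 h)
  | coe e =>
    have h : 0 < ∑ x, Real.exp (e * S x) :=
      Finset.sum_pos (fun _ _ => Real.exp_pos _) Finset.univ_nonempty
    refine ⟨fun a => ?_, ?_⟩
    · simp only [expWeights]
      positivity
    · simp only [expWeights, ← Finset.sum_div]
      exact div_self h.ne'

/-- What AdaHedge keeps in memory between rounds: the sums over the past rounds of the
estimated payoffs `⟨x, ŷ_s⟩` of each action, and of the mixability gaps `δ_s`. -/
structure State (α : Type*) where
  cumEst : α → ℝ
  cumGap : ℝ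

/-- The learning rate `η = (∑ δ_s)⁻¹ ln K`, equal to `+∞` when `∑ δ_s = 0`
(in particular in the first round). -/
def State.rate {α : Type*} [Fintype α] (S : State α) : WithTop ℝ :=
  open Classical in
  if S.cumGap = 0 then ⊤ else (((S.cumGap)⁻¹ * Real.log (Fintype.card α) : ℝ) : WithTop ℝ)

/-- The distribution `q_t`, before mixing with the exploration distribution. -/
def State.q {α : Type*} [Fintype α] (S : State α) : α → ℝ := expWeights S.rate S.cumEst

/-! ### AdaHedge for adversarial linear bandits -/

/-- The matrix `M(p) = ∑_{x ∈ A} p(x) x xᵀ`. -/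
def designMatrix {d : ℕ} {A : Finset (Fin d → ℝ)} (p : A → ℝ) : Matrix (Fin d) (Fin d) ℝ :=
  ∑ x : A, p x • Matrix.vecMulVec (x : Fin d → ℝ) (x : Fin d → ℝ)

/-- A Kiefer–Wolfowitz (G-optimal) design: `M(π)` is invertible and
`max_{x ∈ A} xᵀ M(π)⁻¹ x = d`. -/
def IsOptimalDesign {d : ℕ} {A : Finset (Fin d → ℝ)} (π : stdSimplex ℝ A) : Prop :=
  IsUnit (designMatrix π.1) ∧
    IsGreatest (Set.range fun x : A =>
      (x : Fin d → ℝ) ⬝ᵥ ((designMatrix π.1)⁻¹ *ᵥ (x : Fin d → ℝ))) (d : ℝ)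

/-- The estimate `ŷ = M(p)⁻¹ X ⟨X, y⟩`, computed from the drawn action `X` and its observed
payoff `⟨X, y⟩`. -/
def estimate {d : ℕ} {A : Finset (Fin d → ℝ)} (p : A → ℝ) (X : A) (payoff : ℝ) : Fin d → ℝ :=
  payoff • ((designMatrix p)⁻¹ *ᵥ (X : Fin d → ℝ))

/-- The distribution `p_t = (1 - γ_t) q_t + γ_t π` from which the action is drawn. -/
def State.p {α : Type*} [Fintype α] (π : stdSimplex ℝ α) (γ : Set.Icc (0 : ℝ) 1) (S : State α) :
    α → ℝ :=
  fun a => (1 - (γ : ℝ)) * S.q a + (γ : ℝ) * π.1 a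

theorem State.p_mem {α : Type*} [Fintype α] (π : stdSimplex ℝ α) (γ : Set.Icc (0 : ℝ) 1)
    (S : State α) : S.p π γ ∈ stdSimplex ℝ α := by
  have hne : Nonempty α := by
    by_contra h
    rw [not_nonempty_iff] at h
    have h1 := π.2.2
    simp at h1
  have h := convex_stdSimplex ℝ α (expWeights_mem S.rate S.cumEst) π.2
    (sub_nonneg.2 γ.2.2) γ.2.1 (by ring)
  exact h

/-- The update of the memory at the end of a round with exploration rate `γ`, in which the action
`X` was drawn and its payoff was observed. -/
def State.update {d : ℕ} {A : Finset (Fin d → ℝ)} (π : stdSimplex ℝ A) (γ : Set.Icc (0 : ℝ) 1)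
    (S : State A) (X : A) (payoff : ℝ) : State A :=
  let z : A → ℝ := fun x => (x : Fin d → ℝ) ⬝ᵥ estimate (S.p π γ) X payoff
  { cumEst := fun x => S.cumEst x + z x
    cumGap := S.cumGap + mixabilityGap S.rate S.q z }

/-- The memory after `t` rounds with the given actions and observed payoffs. -/
def stateAfter {d : ℕ} {A : Finset (Fin d → ℝ)} (π : stdSimplex ℝ A)
    (γ : ℕ → Set.Icc (0 : ℝ) 1) : (t : ℕ) → (Fin t → A × ℝ) → State A
  | 0, _ => { cumEst := fun _ => 0, cumGap := 0 }
  | t + 1, h => (stateAfter π γ t (Fin.init h)).update π (γ t)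
      (h (Fin.last t)).1 (h (Fin.last t)).2

/-- AdaHedge for adversarial linear bandits, with exploration distribution `π` and
exploration rates `γ`. -/
def adaHedge {d : ℕ} {A : Finset (Fin d → ℝ)} (π : stdSimplex ℝ A)
    (γ : ℕ → Set.Icc (0 : ℝ) 1) : Strategy A :=
  fun t h => toPMF ⟨(stateAfter π γ t h).p π (γ t), State.p_mem π (γ t) _⟩

/-- The exploration rates `γ_t = min {1/2, √(2.5 d (log K) / t)}`; the value at index `t` is the
rate of round `t + 1`. -/
def explorationRate (d K : ℕ) (t : ℕ) : Set.Icc (0 : ℝ) 1 :=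
  ⟨min (1 / 2) (Real.sqrt (2.5 * d * Real.log K / ((t : ℝ) + 1))),
    le_min (by norm_num) (Real.sqrt_nonneg _), (min_le_left _ _).trans (by norm_num)⟩

end LinearBandit

end

namespace LinearBandit

/-! Existence of a design: a maximizer `π` of `|det M(p)|` over the compact simplex is optimal. Put
g(x) = xᵀM(π)⁻¹x. Moving mass ε towards x multiplies the determinant by (1-ε)^(d-1) (1-ε+ε g(x)), so
maximality forces g ≤ d; the trace identity ∑ π(x) g(x) = d then forces equality somewhere.

Regret bound: write L = ln K, B = M - m, and Δ for the sum of the mixability gaps. The estimates are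
unbiased, so a fixed action can be compared through its cumulative estimate. The potential (1/η)
ln(mean of exp(η S)) grows in a round by at most the `q`-average of the estimates plus δ, and it can
only fall when η decreases. It lies below the cumulative estimate of an action by at most L/η = Δ.
Mixing in `π` costs at most Bγ_t per round. This gives R_T ≤ B ∑ γ_t + 2 E Δ (`regret_adaHedge_le`).

To bound E Δ, let s bound the spread of the estimates and V be their second moment under `q`.
Bernstein's inequality gives δ/η ≤ V/2 + sδ/3 (`mixabilityGap_div_le`). Since 1/η = Δ/L, this
controls the increments of Δ², and since V has conditional mean at most 2dB², summation gives E Δ² -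
(2L/3+1) s E Δ ≤ 2dB²LT. Jensen turns this into a quadratic inequality for E Δ. Optimality of the
design permits s = 2B d / min γ_t, and rates of order √(dL/t) balance this against ∑ γ_t. -/

/-! ### Quadratic upper bounds for the exponential. -/

theorem exp_sub_quadratic_antitone :
    Antitone fun y : ℝ => 1 + y + y ^ 2 / 2 - Real.exp y := by
  have hd : ∀ y : ℝ, HasDerivAt (fun y : ℝ => 1 + y + y ^ 2 / 2 - Real.exp y)
      (1 + y - Real.exp y) y := fun y => by
    have h := ((((hasDerivAt_id y).const_add 1).add
      (((hasDerivAt_id y).pow 2).div_const 2)).sub (Real.hasDerivAt_exp y))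
    exact h.congr_deriv (by simp)
  refine antitone_of_deriv_nonpos (fun y => (hd y).differentiableAt) fun y => ?_
  rw [(hd y).deriv]
  linarith [Real.add_one_le_exp y]

theorem exp_le_quadratic_of_nonpos {y : ℝ} (hy : y ≤ 0) : Real.exp y ≤ 1 + y + y ^ 2 / 2 := by
  have h := exp_sub_quadratic_antitone hy
  simp only [Real.exp_zero] at h
  linarith

/-- This is exp y ≤ 1 + y + y²/(2(1 - y/3)) with the denominator cleared. The difference of the two
sides vanishes at 0 together with its first derivative, and is convex on y ≥ 0. -/
theorem exp_mul_one_sub_le {y : ℝ} (hy : 0 ≤ y) :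
    Real.exp y * (1 - y / 3) ≤ 1 + 2 * y / 3 + y ^ 2 / 6 := by
  set f : ℝ → ℝ := fun y => 1 + 2 * y / 3 + y ^ 2 / 6 - Real.exp y * (1 - y / 3) with hf
  have hd : ∀ y : ℝ, HasDerivAt f
      (2 / 3 + y / 3 - Real.exp y * (1 - y / 3) + Real.exp y / 3) y := fun y => by
    have h := (((((hasDerivAt_id y).const_mul 2).div_const 3).const_add 1).add
      (((hasDerivAt_id y).pow 2).div_const 6)).sub
      ((Real.hasDerivAt_exp y).mul (((hasDerivAt_id y).div_const 3).const_sub 1))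
    exact h.congr_deriv (by simp; ring)
  have hd2 : ∀ y : ℝ, HasDerivAt
      (fun y => 2 / 3 + y / 3 - Real.exp y * (1 - y / 3) + Real.exp y / 3)
      (1 / 3 - Real.exp y * (1 - y / 3) + 2 * Real.exp y / 3) y := fun y => by
    have h := ((((hasDerivAt_id y).div_const 3).const_add (2 / 3)).sub
      ((Real.hasDerivAt_exp y).mul (((hasDerivAt_id y).div_const 3).const_sub 1))).add
      ((Real.hasDerivAt_exp y).div_const 3)
    exact h.congr_deriv (by simp; ring)
  have mono2 : MonotoneOn (fun y => 2 / 3 + y / 3 - Real.exp y * (1 - y / 3) + Real.exp y / 3)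
      (Set.Ici (0 : ℝ)) := by
    refine monotoneOn_of_deriv_nonneg (convex_Ici 0)
      (fun y _ => (hd2 y).continuousAt.continuousWithinAt)
      (fun y _ => (hd2 y).differentiableAt.differentiableWithinAt) fun y hy => ?_
    rw [(hd2 y).deriv]
    rw [interior_Ici, Set.mem_Ioi] at hy
    -- The second derivative is (1 - exp y · (1 - y))/3, nonnegative because exp(-y) ≥ 1 - y.
    have h1 := Real.add_one_le_exp (-y)
    have h2 : Real.exp y * Real.exp (-y) = 1 := by rw [← Real.exp_add]; simp
    nlinarith [Real.exp_pos y]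
  have mono1 : MonotoneOn f (Set.Ici (0 : ℝ)) := by
    refine monotoneOn_of_deriv_nonneg (convex_Ici 0)
      (fun y _ => (hd y).continuousAt.continuousWithinAt)
      (fun y _ => (hd y).differentiableAt.differentiableWithinAt) fun y hy => ?_
    rw [(hd y).deriv]
    rw [interior_Ici, Set.mem_Ioi] at hy
    have := mono2 (Set.self_mem_Ici) hy.le hy.le
    norm_num at this
    linarith
  have h := mono1 Set.self_mem_Ici hy hy
  simp [hf] at h
  linarith

/-- Bernstein's bound on the exponential function. -/
theorem exp_le_bernstein {y u : ℝ} (hyu : y ≤ u) (hu : 0 ≤ u) (hu3 : u < 3) :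
    Real.exp y ≤ 1 + y + y ^ 2 / (2 * (1 - u / 3)) := by
  have hpos : 0 < 2 * (1 - u / 3) := by linarith
  rw [← sub_le_iff_le_add', le_div_iff₀ hpos]
  rcases le_total y 0 with hy | hy
  · have := exp_le_quadratic_of_nonpos hy
    have := Real.add_one_le_exp y
    nlinarith
  · have h := exp_mul_one_sub_le hy
    have := Real.add_one_le_exp y
    nlinarith

/-! ### Bounds on the mixability gap. -/

section Gap

variable {α : Type*} [Fintype α]

theorem sum_mul_le_of_mem_stdSimplex {q z : α → ℝ} (hq : q ∈ stdSimplex ℝ α) {c : ℝ}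
    (hz : ∀ x, z x ≤ c) : ∑ x, q x * z x ≤ c := by
  calc ∑ x, q x * z x ≤ ∑ x, q x * c :=
        Finset.sum_le_sum fun x _ => mul_le_mul_of_nonneg_left (hz x) (hq.1 x)
    _ = c := by rw [← Finset.sum_mul, hq.2, one_mul]

theorem le_sum_mul_of_mem_stdSimplex {q z : α → ℝ} (hq : q ∈ stdSimplex ℝ α) {c : ℝ}
    (hz : ∀ x, c ≤ z x) : c ≤ ∑ x, q x * z x := by
  calc c = ∑ x, q x * c := by rw [← Finset.sum_mul, hq.2, one_mul]
    _ ≤ ∑ x, q x * z x :=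
        Finset.sum_le_sum fun x _ => mul_le_mul_of_nonneg_left (hz x) (hq.1 x)

theorem sum_mul_sub_mean {q : α → ℝ} (hq : q ∈ stdSimplex ℝ α) (z : α → ℝ) :
    ∑ x, q x * (z x - ∑ a, q a * z a) = 0 := by
  simp only [mul_sub, Finset.sum_sub_distrib, ← Finset.sum_mul, hq.2, one_mul, sub_self]

theorem variance_le_second_moment {q : α → ℝ} (hq : q ∈ stdSimplex ℝ α) (z : α → ℝ) :
    ∑ x, q x * (z x - ∑ a, q a * z a) ^ 2 ≤ ∑ x, q x * z x ^ 2 := by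
  set c := ∑ a, q a * z a with hc
  have h : ∑ x, q x * (z x - c) ^ 2 = ∑ x, q x * z x ^ 2 - c ^ 2 := by
    calc ∑ x, q x * (z x - c) ^ 2
        = ∑ x, (q x * z x ^ 2 - 2 * c * (q x * z x) + c ^ 2 * q x) :=
          Finset.sum_congr rfl fun x _ => by ring
      _ = _ := by
          rw [Finset.sum_add_distrib, Finset.sum_sub_distrib, ← Finset.mul_sum, ← Finset.mul_sum,
            hq.2, ← hc]
          ring
  rw [h]
  nlinarith [sq_nonneg c]

theorem sub_mean_le {q z : α → ℝ} (hq : q ∈ stdSimplex ℝ α) {s : ℝ}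
    (hz : ∀ x x', z x - z x' ≤ s) (x : α) : z x - ∑ a, q a * z a ≤ s := by
  have := le_sum_mul_of_mem_stdSimplex hq (c := z x - s) (z := z) fun x' => by
    linarith [hz x x']
  linarith

variable [Nonempty α]

theorem sum_mul_exp_pos {q : α → ℝ} (hq : q ∈ stdSimplex ℝ α) (w : α → ℝ) :
    0 < ∑ x, q x * Real.exp (w x) := by
  obtain ⟨b, hb⟩ := Finite.exists_min w
  exact (Real.exp_pos (w b)).trans_le
    (le_sum_mul_of_mem_stdSimplex hq fun x => Real.exp_le_exp.2 (hb x))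

theorem mixabilityGap_coe_eq {q : α → ℝ} (hq : q ∈ stdSimplex ℝ α) (z : α → ℝ) {e : ℝ}
    (he : 0 < e) :
    mixabilityGap (e : WithTop ℝ) q z =
      1 / e * Real.log (∑ x, q x * Real.exp (e * (z x - ∑ a, q a * z a))) := by
  have h : ∑ x, q x * Real.exp (e * (z x - ∑ a, q a * z a)) =
      (∑ x, q x * Real.exp (e * z x)) * Real.exp (-(e * ∑ a, q a * z a)) := by
    rw [Finset.sum_mul]
    refine Finset.sum_congr rfl fun x _ => ?_
    rw [mul_assoc, ← Real.exp_add]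
    ring_nf
  rw [h, Real.log_mul (sum_mul_exp_pos hq _).ne' (Real.exp_pos _).ne', Real.log_exp]
  simp only [mixabilityGap]
  field_simp
  ring

theorem mixabilityGap_coe_nonneg {q : α → ℝ} (hq : q ∈ stdSimplex ℝ α) (z : α → ℝ) {e : ℝ}
    (he : 0 < e) : 0 ≤ mixabilityGap (e : WithTop ℝ) q z := by
  rw [mixabilityGap_coe_eq hq z he]
  refine mul_nonneg (by positivity) (Real.log_nonneg ?_)
  calc (1 : ℝ) = ∑ x, q x * (e * (z x - ∑ a, q a * z a) + 1) := by
        simp only [mul_add, mul_one, Finset.sum_add_distrib, hq.2, mul_left_comm _ e,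
          ← Finset.mul_sum, sum_mul_sub_mean hq, mul_zero, zero_add]
    _ ≤ _ := Finset.sum_le_sum fun x _ =>
        mul_le_mul_of_nonneg_left (Real.add_one_le_exp _) (hq.1 x)

theorem mixabilityGap_nonneg {q : α → ℝ} (hq : q ∈ stdSimplex ℝ α) (z : α → ℝ) {η : WithTop ℝ}
    (hη : 0 < η) : 0 ≤ mixabilityGap η q z := by
  induction η using WithTop.recTopCoe with
  | top =>
    have := sum_mul_le_of_mem_stdSimplex hq (le_ciSup (Set.finite_range z).bddAbove)
    simp only [mixabilityGap]
    linarith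
  | coe e => exact mixabilityGap_coe_nonneg hq z (by exact_mod_cast hη)

theorem mixabilityGap_le {q z : α → ℝ} (hq : q ∈ stdSimplex ℝ α) {s : ℝ}
    (hz : ∀ x x', z x - z x' ≤ s) {η : WithTop ℝ} (hη : 0 < η) : mixabilityGap η q z ≤ s := by
  induction η using WithTop.recTopCoe with
  | top =>
    have := ciSup_le (f := z) (c := s + ∑ a, q a * z a) fun x => by linarith [sub_mean_le hq hz x]
    simp only [mixabilityGap]
    linarith
  | coe e =>
    have he : 0 < e := by exact_mod_cast hη
    rw [mixabilityGap_coe_eq hq z he, one_div, inv_mul_le_iff₀ he,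
      Real.log_le_iff_le_exp (sum_mul_exp_pos hq _)]
    exact sum_mul_le_of_mem_stdSimplex hq fun x =>
      Real.exp_le_exp.2 (mul_le_mul_of_nonneg_left (sub_mean_le hq hz x) he.le)

/-- Bernstein's bound on the mixability gap. -/
theorem mixabilityGap_div_le {q z : α → ℝ} (hq : q ∈ stdSimplex ℝ α) {s : ℝ}
    (hz : ∀ x x', z x - z x' ≤ s) {e : ℝ} (he : 0 < e) :
    mixabilityGap (e : WithTop ℝ) q z / e ≤
      (∑ x, q x * z x ^ 2) / 2 + s * mixabilityGap (e : WithTop ℝ) q z / 3 := by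
  have h0 := mixabilityGap_coe_nonneg hq z he
  have hs : 0 ≤ s := by
    obtain ⟨x⟩ := ‹Nonempty α›
    simpa using hz x x
  have hsum : 0 ≤ ∑ x, q x * z x ^ 2 :=
    Finset.sum_nonneg fun x _ => mul_nonneg (hq.1 x) (sq_nonneg _)
  set δ := mixabilityGap (e : WithTop ℝ) q z with hδ
  rw [div_le_iff₀ he]
  -- For e·s ≥ 3 the term sδ/3 alone dominates δ/e; Bernstein's bound needs e·s < 3.
  rcases le_or_gt 3 (e * s) with h3 | h3
  · nlinarith [mul_nonneg h0 (sub_nonneg.2 h3), mul_nonneg hsum he.le]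
  have hpos : 0 < 1 - e * s / 3 := by linarith
  set v := ∑ x, q x * (z x - ∑ a, q a * z a) ^ 2 with hv
  have hlog : Real.log (∑ x, q x * Real.exp (e * (z x - ∑ a, q a * z a))) ≤
      e ^ 2 * v / (2 * (1 - e * s / 3)) := by
    -- After log w ≤ w - 1, the linear term of Bernstein's bound averages to zero because `z` is
    -- centred at its `q`-mean.
    refine (Real.log_le_sub_one_of_pos (sum_mul_exp_pos hq _)).trans ?_
    rw [sub_le_iff_le_add']
    calc _ ≤ ∑ x, q x * (1 + e * (z x - ∑ a, q a * z a) +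
            (e * (z x - ∑ a, q a * z a)) ^ 2 / (2 * (1 - e * s / 3))) :=
          Finset.sum_le_sum fun x _ => mul_le_mul_of_nonneg_left
            (exp_le_bernstein (mul_le_mul_of_nonneg_left (sub_mean_le hq hz x) he.le)
              (by positivity) h3) (hq.1 x)
      _ = ∑ x, (q x + e * (q x * (z x - ∑ a, q a * z a)) +
            e ^ 2 / (2 * (1 - e * s / 3)) * (q x * (z x - ∑ a, q a * z a) ^ 2)) :=
          Finset.sum_congr rfl fun x _ => by ring
      _ = _ := by
          rw [Finset.sum_add_distrib, Finset.sum_add_distrib, ← Finset.mul_sum, ← Finset.mul_sum,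
            hq.2, sum_mul_sub_mean hq, ← hv]
          ring
  have hle : e * δ ≤ e ^ 2 * v / (2 * (1 - e * s / 3)) := by
    rw [hδ, mixabilityGap_coe_eq hq z he]
    rwa [← mul_assoc, mul_one_div_cancel he.ne', one_mul]
  rw [le_div_iff₀ (by positivity)] at hle
  have hle2 : δ * (2 * (1 - e * s / 3)) ≤ e * v := by
    refine le_of_mul_le_mul_left ?_ he
    linarith
  have := mul_le_mul_of_nonneg_left (variance_le_second_moment hq z) he.le
  rw [← hv] at this
  linarith

end Gap

/-! ### The log-sum-exp potential. -/

section Potential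

variable {α : Type*} [Fintype α] [Nonempty α]

/-- The normalized log-sum-exp potential of exponential weights; a maximum for `η = +∞`. -/
noncomputable def potential (η : WithTop ℝ) (S : α → ℝ) : ℝ :=
  match η with
  | ⊤ => ⨆ x, S x
  | (e : ℝ) => 1 / e * (Real.log (∑ x, Real.exp (e * S x)) - Real.log (Fintype.card α))

theorem sum_exp_pos (w : α → ℝ) : 0 < ∑ x, Real.exp (w x) :=
  Finset.sum_pos (fun _ _ => Real.exp_pos _) Finset.univ_nonempty

/-- At finite η this is an equality: the gap is defined so as to account for the whole change of the
potential. -/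
theorem potential_add_le (η : WithTop ℝ) (hη : 0 < η) (S z : α → ℝ) :
    potential η (fun x => S x + z x) ≤
      potential η S + ∑ x, expWeights η S x * z x + mixabilityGap η (expWeights η S) z := by
  induction η using WithTop.recTopCoe with
  | top =>
    simp only [potential, mixabilityGap]
    have : ⨆ x, (S x + z x) ≤ (⨆ x, S x) + ⨆ x, z x := ciSup_le fun x =>
      add_le_add (le_ciSup (Set.finite_range S).bddAbove x)
        (le_ciSup (Set.finite_range z).bddAbove x)
    linarith
  | coe e =>
    simp only [potential, mixabilityGap]
    have h : ∑ x, expWeights (e : WithTop ℝ) S x * Real.exp (e * z x) =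
        (∑ x, Real.exp (e * (S x + z x))) / ∑ x, Real.exp (e * S x) := by
      rw [Finset.sum_div]
      refine Finset.sum_congr rfl fun x _ => ?_
      simp only [expWeights]
      rw [mul_add, Real.exp_add]
      ring
    rw [h, Real.log_div (sum_exp_pos _).ne' (sum_exp_pos _).ne']
    linarith

theorem le_potential_coe {e : ℝ} (he : 0 < e) (S : α → ℝ) (x : α) :
    S x ≤ potential (e : WithTop ℝ) S + 1 / e * Real.log (Fintype.card α) := by
  have h : e * S x ≤ Real.log (∑ x, Real.exp (e * S x)) := by
    rw [Real.le_log_iff_exp_le (sum_exp_pos _)]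
    exact Finset.single_le_sum (f := fun x => Real.exp (e * S x))
      (fun _ _ => (Real.exp_pos _).le) (Finset.mem_univ x)
  simp only [potential]
  rw [← mul_add, sub_add_cancel, one_div, le_inv_mul_iff₀ he]
  exact h

theorem card_cast_pos : (0 : ℝ) < Fintype.card α := Nat.cast_pos.2 Fintype.card_pos

theorem potential_coe_le_iff {e : ℝ} (he : 0 < e) (S : α → ℝ) (c : ℝ) :
    potential (e : WithTop ℝ) S ≤ c ↔
      ∑ x, Real.exp (e * (S x - c)) ≤ Fintype.card α := by
  have h : ∑ x, Real.exp (e * (S x - c)) =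
      (∑ x, Real.exp (e * S x)) * Real.exp (-(e * c)) := by
    rw [Finset.sum_mul]
    refine Finset.sum_congr rfl fun x _ => ?_
    rw [← Real.exp_add]
    ring_nf
  rw [h, ← Real.log_le_log_iff (mul_pos (sum_exp_pos _) (Real.exp_pos _)) card_cast_pos,
    Real.log_mul (sum_exp_pos _).ne' (Real.exp_pos _).ne', Real.log_exp]
  simp only [potential]
  rw [one_div, inv_mul_le_iff₀ he]
  constructor <;> intro h <;> linarith

/-- The power-mean inequality. Subtracting ln K makes the potential the logarithm of a mean, and
convexity gives exp(e'u) ≤ (e'/e) exp(eu) + (1 - e'/e). -/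
theorem potential_mono {η η' : WithTop ℝ} (hη' : 0 < η') (h : η' ≤ η) (S : α → ℝ) :
    potential η' S ≤ potential η S := by
  induction η' using WithTop.recTopCoe with
  | top => rw [top_le_iff.1 h]
  | coe e' =>
  have he' : 0 < e' := by exact_mod_cast hη'
  rw [potential_coe_le_iff he']
  induction η using WithTop.recTopCoe with
  | top =>
    calc ∑ x, Real.exp (e' * (S x - potential ⊤ S)) ≤ ∑ _x : α, (1 : ℝ) := by
          refine Finset.sum_le_sum fun x _ => Real.exp_le_one_iff.2 ?_
          refine mul_nonpos_of_nonneg_of_nonpos he'.le (sub_nonpos.2 ?_)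
          exact le_ciSup (Set.finite_range S).bddAbove x
      _ = _ := by simp
  | coe e =>
    have hle : e' ≤ e := by exact_mod_cast h
    have he : 0 < e := he'.trans_le hle
    have h1 := (potential_coe_le_iff he S _).1 le_rfl
    set c := potential (e : WithTop ℝ) S
    have hr : e' / e ≤ 1 := (div_le_one he).2 hle
    have hr0 : 0 ≤ e' / e := by positivity
    calc ∑ x, Real.exp (e' * (S x - c))
        ≤ ∑ x, ((e' / e) * Real.exp (e * (S x - c)) + (1 - e' / e)) := by
          refine Finset.sum_le_sum fun x _ => ?_
          have := convexOn_exp.2 (Set.mem_univ (e * (S x - c))) (Set.mem_univ 0) hr0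
            (sub_nonneg.2 hr) (by ring)
          simp only [smul_eq_mul, mul_zero, add_zero, Real.exp_zero, mul_one] at this
          convert this using 2
          field_simp
      _ = (e' / e) * ∑ x, Real.exp (e * (S x - c)) + (1 - e' / e) * Fintype.card α := by
          rw [Finset.sum_add_distrib, ← Finset.mul_sum]
          simp
          ring
      _ ≤ _ := by nlinarith

end Potential

/-! ### Linear algebra of design matrices. -/

section Design

variable {d : ℕ} {A : Finset (Fin d → ℝ)}

theorem designMatrix_mulVec (p : A → ℝ) (w : Fin d → ℝ) :
    designMatrix p *ᵥ w = ∑ x : A, (p x * ((x : Fin d → ℝ) ⬝ᵥ w)) • (x : Fin d → ℝ) := by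
  rw [designMatrix, Matrix.sum_mulVec]
  refine Finset.sum_congr rfl fun x _ => ?_
  rw [Matrix.smul_mulVec, Matrix.vecMulVec_mulVec, op_smul_eq_smul, smul_smul]

theorem dotProduct_designMatrix_mulVec (p : A → ℝ) (v w : Fin d → ℝ) :
    v ⬝ᵥ (designMatrix p *ᵥ w) =
      ∑ x : A, p x * ((x : Fin d → ℝ) ⬝ᵥ v) * ((x : Fin d → ℝ) ⬝ᵥ w) := by
  rw [designMatrix_mulVec, dotProduct_sum]
  refine Finset.sum_congr rfl fun x _ => ?_
  rw [dotProduct_smul, smul_eq_mul, dotProduct_comm v]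
  ring

theorem designMatrix_isSymm (p : A → ℝ) : (designMatrix p).IsSymm := by
  rw [Matrix.IsSymm, designMatrix, Matrix.transpose_sum]
  simp [Matrix.transpose_vecMulVec]

theorem inv_dotProduct_comm (p : A → ℝ) (v w : Fin d → ℝ) :
    v ⬝ᵥ ((designMatrix p)⁻¹ *ᵥ w) = w ⬝ᵥ ((designMatrix p)⁻¹ *ᵥ v) := by
  conv_lhs => rw [← (designMatrix_isSymm p).inv]
  exact Matrix.dotProduct_transpose_mulVec _ _ _

theorem designMatrix_mulVec_inv {p : A → ℝ} (hp : IsUnit (designMatrix p)) (v : Fin d → ℝ) :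
    designMatrix p *ᵥ ((designMatrix p)⁻¹ *ᵥ v) = v := by
  rw [Matrix.mulVec_mulVec, Matrix.mul_nonsing_inv _ ((Matrix.isUnit_iff_isUnit_det _).1 hp),
    Matrix.one_mulVec]

theorem isUnit_designMatrix_of_forall {p : A → ℝ} (hp : ∀ x, 0 ≤ p x)
    (h : ∀ w : Fin d → ℝ, (∀ x : A, p x * ((x : Fin d → ℝ) ⬝ᵥ w) = 0) → w = 0) :
    IsUnit (designMatrix p) := by
  rw [← Matrix.mulVec_injective_iff_isUnit]
  refine (injective_iff_map_eq_zero ((designMatrix p).mulVecLin)).2 fun w hw => h w fun x => ?_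
  have h0 : w ⬝ᵥ (designMatrix p *ᵥ w) = 0 := by
    rw [← Matrix.mulVecLin_apply, hw, dotProduct_zero]
  rw [dotProduct_designMatrix_mulVec, Finset.sum_eq_zero_iff_of_nonneg fun x _ => by
    rw [mul_assoc]; exact mul_nonneg (hp x) (mul_self_nonneg _)] at h0
  have := h0 x (Finset.mem_univ x)
  rcases mul_eq_zero.1 this with h1 | h1
  · exact h1
  · rw [h1, mul_zero]

theorem isUnit_designMatrix_of_le {p π : A → ℝ} (hπ : ∀ x, 0 ≤ π x)
    (hu : IsUnit (designMatrix π)) {γ : ℝ} (hγ : 0 < γ) (h : ∀ x, γ * π x ≤ p x) :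
    IsUnit (designMatrix p) := by
  refine isUnit_designMatrix_of_forall
    (fun x => (mul_nonneg hγ.le (hπ x)).trans (h x)) fun w hw => ?_
  have h0 : designMatrix π *ᵥ w = 0 := by
    rw [designMatrix_mulVec]
    refine Finset.sum_eq_zero fun x _ => ?_
    rcases mul_eq_zero.1 (hw x) with h1 | h1
    · have : π x = 0 := le_antisymm (by nlinarith [h x]) (hπ x)
      rw [this, zero_mul, zero_smul]
    · rw [h1, mul_zero, zero_smul]
  have := Matrix.mulVec_injective_iff_isUnit.2 hu
  exact this (by rw [h0, Matrix.mulVec_zero])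

/-- Both sides are the trace of M(p)⁻¹M(p). -/
theorem sum_mul_inv_dotProduct_self {p : A → ℝ} (hp : IsUnit (designMatrix p)) :
    ∑ x : A, p x * ((x : Fin d → ℝ) ⬝ᵥ ((designMatrix p)⁻¹ *ᵥ (x : Fin d → ℝ))) = d := by
  have h : ((designMatrix p)⁻¹ * designMatrix p).trace = d := by
    rw [Matrix.nonsing_inv_mul _ ((Matrix.isUnit_iff_isUnit_det _).1 hp), Matrix.trace_one,
      Fintype.card_fin]
  rw [← h]
  conv_rhs => rw [designMatrix, Finset.mul_sum, Matrix.trace_sum, ← designMatrix]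
  refine Finset.sum_congr rfl fun x _ => ?_
  rw [Matrix.mul_smul, Matrix.trace_smul, Matrix.mul_vecMulVec, Matrix.trace_vecMulVec,
    smul_eq_mul, dotProduct_comm]

theorem sum_mul_inv_dotProduct_sq {p : A → ℝ} (hp : IsUnit (designMatrix p)) (v : Fin d → ℝ) :
    ∑ x : A, p x * ((x : Fin d → ℝ) ⬝ᵥ ((designMatrix p)⁻¹ *ᵥ v)) ^ 2 =
      v ⬝ᵥ ((designMatrix p)⁻¹ *ᵥ v) := by
  have h := dotProduct_designMatrix_mulVec p ((designMatrix p)⁻¹ *ᵥ v) ((designMatrix p)⁻¹ *ᵥ v)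
  rw [designMatrix_mulVec_inv hp, dotProduct_comm] at h
  rw [h]
  exact Finset.sum_congr rfl fun x _ => by ring

/-- Unbiasedness of the estimator: averaging X Xᵀ produces M(p), which cancels the inverse. -/
theorem sum_mul_dotProduct_estimate {p : A → ℝ} (hp : IsUnit (designMatrix p))
    (v y : Fin d → ℝ) :
    ∑ a : A, p a * (v ⬝ᵥ estimate p a ((a : Fin d → ℝ) ⬝ᵥ y)) = v ⬝ᵥ y := by
  have h := dotProduct_designMatrix_mulVec p y ((designMatrix p)⁻¹ *ᵥ v)
  rw [designMatrix_mulVec_inv hp, dotProduct_comm] at h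
  rw [h]
  refine Finset.sum_congr rfl fun x _ => ?_
  rw [estimate, dotProduct_smul, smul_eq_mul, inv_dotProduct_comm]
  ring

theorem inv_dotProduct_self_nonneg {p : A → ℝ} (hp0 : ∀ x, 0 ≤ p x)
    (hp : IsUnit (designMatrix p)) (v : Fin d → ℝ) :
    0 ≤ v ⬝ᵥ ((designMatrix p)⁻¹ *ᵥ v) := by
  rw [← sum_mul_inv_dotProduct_sq hp]
  exact Finset.sum_nonneg fun x _ => mul_nonneg (hp0 x) (sq_nonneg _)

/-- Inversion reverses the order M(p) ≥ γM(π). With w = M(p)⁻¹v and u = M(π)⁻¹v, it suffices to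
expand the `π`-average of (γ⟨x,w⟩ - ⟨x,u⟩)² ≥ 0. -/
theorem inv_dotProduct_self_le {p π : A → ℝ} (hπ : ∀ x, 0 ≤ π x)
    (hu : IsUnit (designMatrix π)) {γ : ℝ} (hγ : 0 < γ) (h : ∀ x, γ * π x ≤ p x)
    (v : Fin d → ℝ) :
    v ⬝ᵥ ((designMatrix p)⁻¹ *ᵥ v) ≤ (v ⬝ᵥ ((designMatrix π)⁻¹ *ᵥ v)) / γ := by
  have hp := isUnit_designMatrix_of_le hπ hu hγ h
  set w := (designMatrix p)⁻¹ *ᵥ v with hw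
  set u := (designMatrix π)⁻¹ *ᵥ v with hu'
  have h1 : γ * ∑ x : A, π x * ((x : Fin d → ℝ) ⬝ᵥ w) ^ 2 ≤ v ⬝ᵥ w := by
    rw [← sum_mul_inv_dotProduct_sq hp, Finset.mul_sum]
    refine Finset.sum_le_sum fun x _ => ?_
    rw [← mul_assoc]
    exact mul_le_mul_of_nonneg_right (h x) (sq_nonneg _)
  have h2 : ∑ x : A, π x * ((x : Fin d → ℝ) ⬝ᵥ u) ^ 2 = v ⬝ᵥ u := sum_mul_inv_dotProduct_sq hu v
  have h3 : ∑ x : A, π x * ((x : Fin d → ℝ) ⬝ᵥ w) * ((x : Fin d → ℝ) ⬝ᵥ u) = v ⬝ᵥ w := by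
    rw [← dotProduct_designMatrix_mulVec, hu', designMatrix_mulVec_inv hu, dotProduct_comm]
  have h4 : 0 ≤ ∑ x : A, π x * (γ * ((x : Fin d → ℝ) ⬝ᵥ w) - (x : Fin d → ℝ) ⬝ᵥ u) ^ 2 :=
    Finset.sum_nonneg fun x _ => mul_nonneg (hπ x) (sq_nonneg _)
  have h5 : ∑ x : A, π x * (γ * ((x : Fin d → ℝ) ⬝ᵥ w) - (x : Fin d → ℝ) ⬝ᵥ u) ^ 2 =
      γ * (γ * ∑ x : A, π x * ((x : Fin d → ℝ) ⬝ᵥ w) ^ 2)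
        - 2 * γ * ∑ x : A, π x * ((x : Fin d → ℝ) ⬝ᵥ w) * ((x : Fin d → ℝ) ⬝ᵥ u)
        + ∑ x : A, π x * ((x : Fin d → ℝ) ⬝ᵥ u) ^ 2 := by
    simp only [Finset.mul_sum]
    rw [← Finset.sum_sub_distrib, ← Finset.sum_add_distrib]
    exact Finset.sum_congr rfl fun x _ => by ring
  rw [h5, h2, h3] at h4
  rw [le_div_iff₀ hγ]
  have := mul_le_mul_of_nonneg_left h1 hγ.le
  linarith

/-- Positivity of the quadratic form at v ± w, a substitute for Cauchy–Schwarz. -/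
theorem abs_inv_dotProduct_le {p : A → ℝ} (hp0 : ∀ x, 0 ≤ p x)
    (hp : IsUnit (designMatrix p)) {v w : Fin d → ℝ} {c : ℝ}
    (hv : v ⬝ᵥ ((designMatrix p)⁻¹ *ᵥ v) ≤ c) (hw : w ⬝ᵥ ((designMatrix p)⁻¹ *ᵥ w) ≤ c) :
    |v ⬝ᵥ ((designMatrix p)⁻¹ *ᵥ w)| ≤ c := by
  have h1 := inv_dotProduct_self_nonneg hp0 hp (v + w)
  have h2 := inv_dotProduct_self_nonneg hp0 hp (v - w)
  have h3 := inv_dotProduct_comm p v w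
  simp only [Matrix.mulVec_add, Matrix.mulVec_sub, add_dotProduct, sub_dotProduct,
    dotProduct_add, dotProduct_sub] at h1 h2
  rw [abs_le]
  constructor <;> linarith

/-! ### Existence of Kiefer–Wolfowitz designs -/

/-- The matrix determinant lemma; one of the n + 1 factors 1 - ε is absorbed to clear the fraction
ε/(1 - ε). -/
theorem det_smul_add_vecMulVec {n : ℕ} {N : Matrix (Fin (n + 1)) (Fin (n + 1)) ℝ}
    (hN : IsUnit N.det) (x : Fin (n + 1) → ℝ) {ε : ℝ} (hε : ε < 1) :
    ((1 - ε) • N + ε • Matrix.vecMulVec x x).det =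
      N.det * ((1 - ε) ^ n * (1 - ε + ε * (x ⬝ᵥ (N⁻¹ *ᵥ x)))) := by
  have h1 : (1 - ε) ≠ 0 := by linarith
  have h2 : (1 - ε) • N + ε • Matrix.vecMulVec x x =
      (1 - ε) • (N + Matrix.replicateCol Unit ((ε / (1 - ε)) • x) *
        Matrix.replicateRow Unit x) := by
    rw [← Matrix.vecMulVec_eq, smul_add, Matrix.smul_vecMulVec, smul_smul, mul_div_cancel₀ _ h1]
  rw [h2, Matrix.det_smul, Matrix.det_add_replicateCol_mul_replicateRow hN, Fintype.card_fin]
  have h3 : (1 + Matrix.replicateRow Unit x * N⁻¹ *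
      Matrix.replicateCol Unit ((ε / (1 - ε)) • x)).det =
      1 + ε / (1 - ε) * (x ⬝ᵥ (N⁻¹ *ᵥ x)) := by
    rw [Matrix.det_unique, Matrix.add_apply, Matrix.one_apply_eq, Matrix.mul_assoc]
    congr 1
    rw [← Matrix.replicateCol_mulVec, Matrix.mulVec_smul]
    simp [Matrix.mul_apply, dotProduct, Finset.mul_sum, mul_left_comm]
  rw [h3, pow_succ]
  field_simp

/-- The left side of the hypothesis equals 1 at ε = 0 and has slope g - (n + 1) there; Bernoulli's
inequality replaces the derivative. -/
theorem le_of_forall_pow_mul_le_one {n : ℕ} {g : ℝ} (hg : 0 ≤ g)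
    (h : ∀ ε : ℝ, 0 < ε → ε < 1 → (1 - ε) ^ n * (1 - ε + ε * g) ≤ 1) : g ≤ (n : ℝ) + 1 := by
  by_contra! hlt
  set ε : ℝ := (g - (n + 1)) / (2 * ((n + 1) * g)) with hε
  have hn : (0 : ℝ) ≤ n := n.cast_nonneg
  have hgpos : 0 < g := by linarith
  have hε0 : 0 < ε := div_pos (by linarith) (by positivity)
  have hεeq : ε * (2 * ((n + 1) * g)) = g - (n + 1) := div_mul_cancel₀ _ (by positivity)
  have hε1 : ε < 1 := by
    rw [hε, div_lt_one (by positivity)]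
    nlinarith
  have h1 := h ε hε0 hε1
  have h2 := one_add_mul_le_pow (show -2 ≤ -ε by linarith) n
  have h3 : (1 + n * -ε) * (1 - ε + ε * g) ≤ 1 := by
    refine (mul_le_mul_of_nonneg_right h2 ?_).trans h1
    have := mul_pos hε0 hgpos
    linarith
  -- After cancelling ε, the left side is 2(n+1)gε by the choice of ε, too large for the right side.
  have h4 : ε * (g - (n + 1)) ≤ ε * (n * ε * (g - 1)) := by nlinarith
  have h5 := le_of_mul_le_mul_left h4 hε0
  nlinarith [mul_pos hε0 hgpos, mul_nonneg hn hε0.le]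

theorem continuous_designMatrix : Continuous fun p : A → ℝ => designMatrix p := by
  unfold designMatrix
  fun_prop

theorem designMatrix_mix_single [DecidableEq A] (π : A → ℝ) (ε : ℝ) (x : A) :
    designMatrix ((1 - ε) • π + ε • Pi.single x (1 : ℝ)) =
      (1 - ε) • designMatrix π +
        ε • Matrix.vecMulVec (x : Fin d → ℝ) (x : Fin d → ℝ) := by
  simp only [designMatrix, Pi.add_apply, Pi.smul_apply, smul_eq_mul, add_smul,
    Finset.sum_add_distrib, Finset.smul_sum, smul_smul]
  congr 1
  rw [Finset.sum_eq_single x (fun b _ hb => by simp [hb]) (by simp)]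
  simp

theorem exists_isUnit_designMatrix (hA : A.Nonempty)
    (hspan : Submodule.span ℝ (A : Set (Fin d → ℝ)) = ⊤) :
    ∃ p ∈ stdSimplex ℝ A, IsUnit (designMatrix p) := by
  have : Nonempty A := hA.to_subtype
  have hc : (0 : ℝ) < Fintype.card A := Nat.cast_pos.2 Fintype.card_pos
  refine ⟨fun _ => (Fintype.card A : ℝ)⁻¹, ⟨fun _ => by positivity, ?_⟩, ?_⟩
  · rw [Finset.sum_const, Finset.card_univ, nsmul_eq_mul, mul_inv_cancel₀ hc.ne']
  refine isUnit_designMatrix_of_forall (fun _ => by positivity) fun w hw => ?_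
  have h : ∀ v ∈ Submodule.span ℝ (A : Set (Fin d → ℝ)), v ⬝ᵥ w = 0 := by
    intro v hv
    induction hv using Submodule.span_induction with
    | mem v hv => exact (mul_eq_zero.1 (hw ⟨v, hv⟩)).resolve_left (inv_pos.2 hc).ne'
    | zero => exact zero_dotProduct w
    | add a b _ _ ha hb => rw [add_dotProduct, ha, hb, add_zero]
    | smul c a _ ha => rw [smul_dotProduct, ha, smul_zero]
  exact dotProduct_self_eq_zero.1 (h w (hspan ▸ Submodule.mem_top))

/-- A design that maximizes the determinant is optimal. -/
theorem exists_isOptimalDesign (hA : A.Nonempty)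
    (hspan : Submodule.span ℝ (A : Set (Fin d → ℝ)) = ⊤) :
    ∃ π : stdSimplex ℝ A, IsOptimalDesign π := by
  classical
  obtain ⟨p₀, hp₀, hu₀⟩ := exists_isUnit_designMatrix hA hspan
  -- The absolute value spares a proof that the determinant is nonnegative.
  obtain ⟨π, hπ, hmax⟩ := (isCompact_stdSimplex ℝ A).exists_isMaxOn ⟨p₀, hp₀⟩
    (f := fun p => |(designMatrix p).det|) (continuous_designMatrix.matrix_det.abs.continuousOn)
  have hdet : 0 < |(designMatrix π).det| :=
    (abs_pos.2 ((Matrix.isUnit_iff_isUnit_det _).1 hu₀).ne_zero).trans_le (hmax hp₀)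
  have hunit : IsUnit (designMatrix π).det := (abs_pos.1 hdet).isUnit
  have hu : IsUnit (designMatrix π) := (Matrix.isUnit_iff_isUnit_det _).2 hunit
  have hle : ∀ x : A, (x : Fin d → ℝ) ⬝ᵥ ((designMatrix π)⁻¹ *ᵥ (x : Fin d → ℝ)) ≤ d := by
    intro x
    have hg := inv_dotProduct_self_nonneg hπ.1 hu (x : Fin d → ℝ)
    cases d with
    | zero => simp [dotProduct]
    | succ n =>
      push_cast
      refine le_of_forall_pow_mul_le_one hg fun ε hε0 hε1 => ?_
      have hmem := convex_stdSimplex ℝ A hπ (single_mem_stdSimplex ℝ x)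
        (sub_nonneg.2 hε1.le) hε0.le (by ring)
      have h := hmax hmem
      simp only [Set.mem_ofPred_eq] at h
      rw [designMatrix_mix_single, det_smul_add_vecMulVec hunit _ hε1, abs_mul] at h
      have h1 := (mul_le_iff_le_one_right hdet).1 h
      exact (le_abs_self _).trans h1
  refine ⟨⟨π, hπ⟩, hu, ?_, ?_⟩
  -- If every value were below d, so would be their `π`-average, which is d.
  · by_contra hne
    have hlt : ∀ x : A, (x : Fin d → ℝ) ⬝ᵥ ((designMatrix π)⁻¹ *ᵥ (x : Fin d → ℝ)) < d :=
      fun x => lt_of_le_of_ne (hle x) fun h => hne ⟨x, h⟩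
    have : Nonempty A := hA.to_subtype
    obtain ⟨b, hb⟩ := Finite.exists_max fun x : A =>
      (x : Fin d → ℝ) ⬝ᵥ ((designMatrix π)⁻¹ *ᵥ (x : Fin d → ℝ))
    have := sum_mul_le_of_mem_stdSimplex hπ hb
    rw [sum_mul_inv_dotProduct_self hu] at this
    exact (hlt b).not_ge this
  · rintro _ ⟨x, rfl⟩
    exact hle x

end Design

/-! ### Expectations over finite types as sums. -/

section Expectation

/-- The expectation of a function on a finite type. -/
noncomputable def expect {β : Type*} [Fintype β] (p : PMF β) (f : β → ℝ) : ℝ :=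
  ∑ x, (p x).toReal * f x

variable {β δ : Type*} [Fintype β] [Fintype δ]

theorem sum_toReal (p : PMF β) : ∑ x, (p x).toReal = 1 := by
  rw [← ENNReal.toReal_sum fun x _ => p.apply_ne_top x, ← tsum_fintype (L := .unconditional β),
    p.tsum_coe, ENNReal.toReal_one]

theorem expect_const (p : PMF β) (c : ℝ) : expect p (fun _ => c) = c := by
  rw [expect, ← Finset.sum_mul, sum_toReal, one_mul]

theorem expect_add (p : PMF β) (f g : β → ℝ) :
    expect p (fun x => f x + g x) = expect p f + expect p g := by
  simp only [expect, mul_add, Finset.sum_add_distrib]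

theorem expect_sub (p : PMF β) (f g : β → ℝ) :
    expect p (fun x => f x - g x) = expect p f - expect p g := by
  simp only [expect, mul_sub, Finset.sum_sub_distrib]

theorem expect_const_mul (p : PMF β) (c : ℝ) (f : β → ℝ) :
    expect p (fun x => c * f x) = c * expect p f := by
  simp only [expect, Finset.mul_sum, mul_left_comm]

theorem expect_mono (p : PMF β) {f g : β → ℝ} (h : ∀ x, f x ≤ g x) :
    expect p f ≤ expect p g :=
  Finset.sum_le_sum fun x _ => mul_le_mul_of_nonneg_left (h x) ENNReal.toReal_nonneg

theorem sq_expect_le (p : PMF β) (f : β → ℝ) : expect p f ^ 2 ≤ expect p fun x => f x ^ 2 := by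
  set c := expect p f with hc
  have h : 0 ≤ expect p fun x => (f x - c) ^ 2 :=
    Finset.sum_nonneg fun x _ => mul_nonneg ENNReal.toReal_nonneg (sq_nonneg _)
  have h2 : (expect p fun x => (f x - c) ^ 2) = (expect p fun x => f x ^ 2) - c ^ 2 := by
    have : (fun x => (f x - c) ^ 2) = fun x => (f x ^ 2 - 2 * c * f x) + c ^ 2 := by
      funext x; ring
    rw [this, expect_add, expect_sub, expect_const_mul, expect_const, ← hc]
    ring
  linarith

theorem expect_pure [DecidableEq β] (x : β) (f : β → ℝ) : expect (PMF.pure x) f = f x := by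
  rw [expect, Finset.sum_eq_single x (fun b _ hb => by simp [hb]) (by simp)]
  simp

theorem expect_bind (p : PMF β) (g : β → PMF δ) (f : δ → ℝ) :
    expect (p.bind g) f = expect p fun x => expect (g x) f := by
  simp only [expect, PMF.bind_apply, tsum_fintype, Finset.mul_sum]
  rw [Finset.sum_comm]
  refine Finset.sum_congr rfl fun y _ => ?_
  rw [ENNReal.toReal_sum fun x _ => ENNReal.mul_ne_top (p.apply_ne_top x) ((g x).apply_ne_top y),
    Finset.sum_mul]
  simp only [ENNReal.toReal_mul, mul_assoc]

theorem expect_map (p : PMF β) (h : β → δ) (f : δ → ℝ) :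
    expect (p.map h) f = expect p fun x => f (h x) := by
  classical
  rw [← PMF.bind_pure_comp, expect_bind]
  simp only [Function.comp_apply, expect_pure]

theorem expect_toPMF (p : stdSimplex ℝ β) (f : β → ℝ) :
    expect (toPMF p) f = ∑ x, p.1 x * f x := by
  refine Finset.sum_congr rfl fun x _ => ?_
  rw [toPMF, PMF.ofFintype_apply, ENNReal.toReal_ofReal (p.2.1 x)]

theorem expect_actionLaw_succ (σ : Strategy β) (r : ℕ → β → ℝ) (T : ℕ)
    (F : (Fin (T + 1) → β) → ℝ) :
    expect (actionLaw σ r (T + 1)) F = expect (actionLaw σ r T) fun X =>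
      expect (σ T fun s => (X s, r s (X s))) fun a => F (Fin.snoc X a : Fin (T + 1) → β) := by
  rw [actionLaw, expect_bind]
  simp only [expect_map]

end Expectation

/-! ### One round of the algorithm. -/

section Step

variable {d : ℕ} {A : Finset (Fin d → ℝ)}

theorem State.rate_pos {α : Type*} [Fintype α] (hK : 1 < Fintype.card α) {S : State α}
    (hS : 0 ≤ S.cumGap) : 0 < S.rate := by
  unfold State.rate
  split_ifs with h
  · exact WithTop.coe_lt_top 0
  · have h1 : 0 < S.cumGap := lt_of_le_of_ne hS (Ne.symm h)
    have h2 : 0 < Real.log (Fintype.card α) := Real.log_pos (by exact_mod_cast hK)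
    exact_mod_cast mul_pos (inv_pos.2 h1) h2

theorem State.rate_anti {α : Type*} [Fintype α] (hK : 1 < Fintype.card α) {S S' : State α}
    (hS : 0 ≤ S.cumGap) (h : S.cumGap ≤ S'.cumGap) : S'.rate ≤ S.rate := by
  unfold State.rate
  split_ifs with h1 h2 h2
  · exact le_rfl
  · exact absurd (le_antisymm (h1 ▸ h) hS) h2
  · exact le_top
  · have hpos : 0 < S.cumGap := lt_of_le_of_ne hS (Ne.symm h2)
    have : 0 ≤ Real.log (Fintype.card α) := Real.log_nonneg (by exact_mod_cast hK.le)
    exact_mod_cast mul_le_mul_of_nonneg_right (inv_anti₀ hpos h) this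

/-- The estimated payoffs of all actions, when action `a` is drawn in the state `S` and the
payoffs are given by `y`. -/
noncomputable def State.est (S : State A) (π : stdSimplex ℝ A) (γ : Set.Icc (0 : ℝ) 1)
    (a : A) (y : Fin d → ℝ) (x : A) : ℝ :=
  (x : Fin d → ℝ) ⬝ᵥ estimate (S.p π γ) a ((a : Fin d → ℝ) ⬝ᵥ y)

/-- The potential of the cumulative estimates at the current learning rate. -/
noncomputable def State.pot {α : Type*} [Fintype α] [Nonempty α] (S : State α) : ℝ :=
  potential S.rate S.cumEst

theorem State.q_mem {α : Type*} [Fintype α] [Nonempty α] (S : State α) :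
    S.q ∈ stdSimplex ℝ α := expWeights_mem _ _

/-- The AdaHedge rate is chosen so that the overhead (ln K)/η equals the accumulated gap. -/
theorem State.cumEst_le_pot_add {α : Type*} [Fintype α] [Nonempty α]
    (hK : 1 < Fintype.card α) {S : State α} (hS : 0 ≤ S.cumGap) (x : α) :
    S.cumEst x ≤ S.pot + S.cumGap := by
  unfold State.pot State.rate
  have hL : 0 < Real.log (Fintype.card α) := Real.log_pos (by exact_mod_cast hK)
  split_ifs with h
  · rw [h, add_zero]
    exact le_ciSup (Set.finite_range S.cumEst).bddAbove x
  · have hpos : 0 < S.cumGap := lt_of_le_of_ne hS (Ne.symm h)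
    have := le_potential_coe (mul_pos (inv_pos.2 hpos) hL) S.cumEst x
    convert this using 2
    field_simp

theorem State.cumGap_le_update [Nonempty A] (hK : 1 < Fintype.card A) {S : State A}
    (hS : 0 ≤ S.cumGap) (π : stdSimplex ℝ A) (γ : Set.Icc (0 : ℝ) 1) (a : A) (r : ℝ) :
    S.cumGap ≤ (S.update π γ a r).cumGap :=
  le_add_of_nonneg_right (mixabilityGap_nonneg S.q_mem _ (State.rate_pos hK hS))

theorem stateAfter_cumGap_nonneg [Nonempty A] (hK : 1 < Fintype.card A) (π : stdSimplex ℝ A)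
    (γ : ℕ → Set.Icc (0 : ℝ) 1) (T : ℕ) (h : Fin T → A × ℝ) :
    0 ≤ (stateAfter π γ T h).cumGap := by
  induction T with
  | zero => exact le_rfl
  | succ T ih => exact (ih _).trans (State.cumGap_le_update hK (ih _) _ _ _ _)

theorem State.pot_update_le [Nonempty A] (hK : 1 < Fintype.card A) {S : State A}
    (hS : 0 ≤ S.cumGap) (π : stdSimplex ℝ A) (γ : Set.Icc (0 : ℝ) 1) (a : A) (y : Fin d → ℝ) :
    (S.update π γ a ((a : Fin d → ℝ) ⬝ᵥ y)).pot -
        (S.update π γ a ((a : Fin d → ℝ) ⬝ᵥ y)).cumGap ≤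
      S.pot - S.cumGap + ∑ x, S.q x * S.est π γ a y x := by
  have hle := State.cumGap_le_update hK hS π γ a ((a : Fin d → ℝ) ⬝ᵥ y)
  have h1 := potential_mono (State.rate_pos hK (hS.trans hle)) (State.rate_anti hK hS hle)
    (S.update π γ a ((a : Fin d → ℝ) ⬝ᵥ y)).cumEst
  have h2 := potential_add_le S.rate (State.rate_pos hK hS) S.cumEst (S.est π γ a y)
  have h3 : (S.update π γ a ((a : Fin d → ℝ) ⬝ᵥ y)).cumGap =
    S.cumGap + mixabilityGap S.rate S.q (S.est π γ a y) := rfl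
  have h4 : (S.update π γ a ((a : Fin d → ℝ) ⬝ᵥ y)).cumEst =
    fun x => S.cumEst x + S.est π γ a y x := rfl
  rw [h4] at h1
  rw [h3]
  unfold State.pot
  rw [h4]
  unfold State.q
  linarith

/-- With L = ln K: (Δ+δ)² - Δ² = 2Δδ + δ², where Δδ = Lδ/η is bounded by Bernstein and δ² ≤ sδ. The
terms linear in δ are moved to the left so that they telescope too. -/
theorem State.sq_cumGap_update_le [Nonempty A] (hK : 1 < Fintype.card A) {S : State A}
    (hS : 0 ≤ S.cumGap) (π : stdSimplex ℝ A) (γ : Set.Icc (0 : ℝ) 1) (a : A) (y : Fin d → ℝ)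
    {s : ℝ} (hs : ∀ x x', S.est π γ a y x - S.est π γ a y x' ≤ s) :
    (S.update π γ a ((a : Fin d → ℝ) ⬝ᵥ y)).cumGap ^ 2 -
        (2 / 3 * Real.log (Fintype.card A) + 1) * s *
          (S.update π γ a ((a : Fin d → ℝ) ⬝ᵥ y)).cumGap ≤
      S.cumGap ^ 2 - (2 / 3 * Real.log (Fintype.card A) + 1) * s * S.cumGap +
        Real.log (Fintype.card A) * ∑ x, S.q x * S.est π γ a y x ^ 2 := by
  have h3 : (S.update π γ a ((a : Fin d → ℝ) ⬝ᵥ y)).cumGap =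
    S.cumGap + mixabilityGap S.rate S.q (S.est π γ a y) := rfl
  rw [h3]
  have h0 := mixabilityGap_nonneg S.q_mem (S.est π γ a y) (State.rate_pos hK hS)
  have h1 := mixabilityGap_le S.q_mem hs (State.rate_pos hK hS)
  set z := S.est π γ a y with hz
  have hL : 0 < Real.log (Fintype.card A) := Real.log_pos (by exact_mod_cast hK)
  have hV : 0 ≤ ∑ x, S.q x * z x ^ 2 :=
    Finset.sum_nonneg fun x _ => mul_nonneg (S.q_mem.1 x) (sq_nonneg _)
  have key : S.cumGap * mixabilityGap S.rate S.q z ≤ Real.log (Fintype.card A) *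
      ((∑ x, S.q x * z x ^ 2) / 2 + s * mixabilityGap S.rate S.q z / 3) := by
    -- At infinite rate Bernstein's bound is unavailable, but then the left side is zero.
    by_cases h : S.cumGap = 0
    · rw [h, zero_mul]
      have := mul_nonneg (h0.trans h1) h0
      positivity
    · have hpos : 0 < S.cumGap := lt_of_le_of_ne hS (Ne.symm h)
      have hr : S.rate = ((S.cumGap⁻¹ * Real.log (Fintype.card A) : ℝ) : WithTop ℝ) := if_neg h
      have hb := mixabilityGap_div_le S.q_mem hs (mul_pos (inv_pos.2 hpos) hL)
      rw [← hr] at hb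
      have := mul_le_mul_of_nonneg_left hb hL.le
      refine le_trans (le_of_eq ?_) this
      field_simp
  nlinarith [mul_le_mul_of_nonneg_right h1 h0]

theorem stateP_ge (S : State A) [Nonempty A] (π : stdSimplex ℝ A) (γ : Set.Icc (0 : ℝ) 1)
    (x : A) : (γ : ℝ) * π.1 x ≤ S.p π γ x :=
  le_add_of_nonneg_left (mul_nonneg (sub_nonneg.2 γ.2.2) (S.q_mem.1 x))

theorem State.isUnit_designMatrix [Nonempty A] {π : stdSimplex ℝ A} (hπ : IsOptimalDesign π)
    (S : State A) {γ : Set.Icc (0 : ℝ) 1} (hγ : 0 < (γ : ℝ)) :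
    IsUnit (designMatrix (S.p π γ)) :=
  isUnit_designMatrix_of_le π.2.1 hπ.1 hγ (stateP_ge S π γ)

theorem State.abs_est_le [Nonempty A] {π : stdSimplex ℝ A} (hπ : IsOptimalDesign π)
    (S : State A) {γ : Set.Icc (0 : ℝ) 1} (hγ : 0 < (γ : ℝ)) {y : Fin d → ℝ} {B : ℝ}
    (hy : ∀ a : A, |(a : Fin d → ℝ) ⬝ᵥ y| ≤ B) (a x : A) :
    |S.est π γ a y x| ≤ B * (d / γ) := by
  have hle : ∀ v : A, (v : Fin d → ℝ) ⬝ᵥ ((designMatrix (S.p π γ))⁻¹ *ᵥ (v : Fin d → ℝ)) ≤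
      d / γ := fun v =>
    (inv_dotProduct_self_le π.2.1 hπ.1 hγ (stateP_ge S π γ) _).trans
      (div_le_div_of_nonneg_right (hπ.2.2 ⟨v, rfl⟩) hγ.le)
  rw [State.est, estimate, dotProduct_smul, smul_eq_mul, abs_mul]
  exact mul_le_mul (hy a)
    (abs_inv_dotProduct_le (State.p_mem π γ S).1 (S.isUnit_designMatrix hπ hγ) (hle x) (hle a))
    (abs_nonneg _) ((abs_nonneg _).trans (hy a))

theorem State.sum_p_mul_est [Nonempty A] {π : stdSimplex ℝ A} (hπ : IsOptimalDesign π)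
    (S : State A) {γ : Set.Icc (0 : ℝ) 1} (hγ : 0 < (γ : ℝ)) (y : Fin d → ℝ) (x : A) :
    ∑ a, S.p π γ a * S.est π γ a y x = (x : Fin d → ℝ) ⬝ᵥ y :=
  sum_mul_dotProduct_estimate (S.isUnit_designMatrix hπ hγ) _ y

theorem State.sum_p_mul_sum_q_mul_est [Nonempty A] {π : stdSimplex ℝ A}
    (hπ : IsOptimalDesign π) (S : State A) {γ : Set.Icc (0 : ℝ) 1} (hγ : 0 < (γ : ℝ))
    (y : Fin d → ℝ) :
    ∑ a, S.p π γ a * ∑ x, S.q x * S.est π γ a y x = ∑ x : A, S.q x * ((x : Fin d → ℝ) ⬝ᵥ y) := by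
  simp only [← S.sum_p_mul_est hπ hγ y, Finset.mul_sum]
  rw [Finset.sum_comm]
  exact Finset.sum_congr rfl fun x _ => Finset.sum_congr rfl fun a _ => by ring

/-- Since γ ≤ 1/2, q ≤ 2p. Under p the inner sum is at most B² aᵀM(p)⁻¹a, whose p-average is B²d by
the trace identity. -/
theorem State.sum_p_mul_sum_q_mul_est_sq_le [Nonempty A] {π : stdSimplex ℝ A}
    (hπ : IsOptimalDesign π) (S : State A) {γ : Set.Icc (0 : ℝ) 1} (hγ : 0 < (γ : ℝ))
    (hγ' : (γ : ℝ) ≤ 1 / 2) {y : Fin d → ℝ} {B : ℝ}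
    (hy : ∀ a : A, |(a : Fin d → ℝ) ⬝ᵥ y| ≤ B) :
    ∑ a, S.p π γ a * ∑ x, S.q x * S.est π γ a y x ^ 2 ≤ 2 * d * B ^ 2 := by
  have hp := S.isUnit_designMatrix hπ hγ
  have hp0 := (State.p_mem π γ S).1
  have hq : ∀ x, S.q x ≤ 2 * S.p π γ x := fun x => by
    have h1 := S.q_mem.1 x
    have h2 := mul_nonneg hγ.le (π.2.1 x)
    change S.q x ≤ 2 * ((1 - (γ : ℝ)) * S.q x + (γ : ℝ) * π.1 x)
    nlinarith
  have hin : ∀ a : A, ∑ x, S.q x * S.est π γ a y x ^ 2 ≤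
      2 * B ^ 2 * ((a : Fin d → ℝ) ⬝ᵥ ((designMatrix (S.p π γ))⁻¹ *ᵥ (a : Fin d → ℝ))) := by
    intro a
    have hB : ((a : Fin d → ℝ) ⬝ᵥ y) ^ 2 ≤ B ^ 2 := by
      rw [← sq_abs]
      exact pow_le_pow_left₀ (abs_nonneg _) (hy a) 2
    rw [← sum_mul_inv_dotProduct_sq hp, Finset.mul_sum]
    refine Finset.sum_le_sum fun x _ => ?_
    rw [State.est, estimate, dotProduct_smul, smul_eq_mul, mul_pow]
    set u := ((x : Fin d → ℝ) ⬝ᵥ ((designMatrix (S.p π γ))⁻¹ *ᵥ (a : Fin d → ℝ))) ^ 2 with hu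
    have hu0 : 0 ≤ u := sq_nonneg _
    calc S.q x * (((a : Fin d → ℝ) ⬝ᵥ y) ^ 2 * u) ≤ (2 * S.p π γ x) * (B ^ 2 * u) :=
          mul_le_mul (hq x) (mul_le_mul_of_nonneg_right hB hu0)
            (mul_nonneg (sq_nonneg _) hu0) (mul_nonneg zero_le_two (hp0 x))
      _ = _ := by ring
  calc _ ≤ ∑ a : A, S.p π γ a * (2 * B ^ 2 *
          ((a : Fin d → ℝ) ⬝ᵥ ((designMatrix (S.p π γ))⁻¹ *ᵥ (a : Fin d → ℝ)))) :=
        Finset.sum_le_sum fun a _ => mul_le_mul_of_nonneg_left (hin a) (hp0 a)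
    _ = 2 * B ^ 2 * ∑ a : A, S.p π γ a *
          ((a : Fin d → ℝ) ⬝ᵥ ((designMatrix (S.p π γ))⁻¹ *ᵥ (a : Fin d → ℝ))) := by
        rw [Finset.mul_sum]
        exact Finset.sum_congr rfl fun a _ => by ring
    _ = _ := by
        rw [sum_mul_inv_dotProduct_self hp]
        ring

theorem State.sum_q_sub_sum_p_le [Nonempty A] (π : stdSimplex ℝ A) (S : State A)
    (γ : Set.Icc (0 : ℝ) 1) {y : Fin d → ℝ} {m M : ℝ}
    (hy : ∀ a : A, (a : Fin d → ℝ) ⬝ᵥ y ∈ Set.Icc m M) :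
    ∑ x : A, S.q x * ((x : Fin d → ℝ) ⬝ᵥ y) - ∑ x : A, S.p π γ x * ((x : Fin d → ℝ) ⬝ᵥ y) ≤
      (M - m) * γ := by
  have h1 := sum_mul_le_of_mem_stdSimplex S.q_mem fun a => (hy a).2
  have h2 := le_sum_mul_of_mem_stdSimplex π.2 fun a => (hy a).1
  have h3 : ∑ x : A, S.p π γ x * ((x : Fin d → ℝ) ⬝ᵥ y) =
      (1 - γ) * ∑ x : A, S.q x * ((x : Fin d → ℝ) ⬝ᵥ y) +
        γ * ∑ x : A, π.1 x * ((x : Fin d → ℝ) ⬝ᵥ y) := by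
    rw [Finset.mul_sum, Finset.mul_sum, ← Finset.sum_add_distrib]
    refine Finset.sum_congr rfl fun x _ => ?_
    rw [State.p]
    ring
  rw [h3]
  nlinarith [mul_le_mul_of_nonneg_left (sub_le_sub h1 h2) γ.2.1]

end Step

/-! ### Regret in terms of the exploration rates and the expected gap. -/

section Regret

variable {d : ℕ} {A : Finset (Fin d → ℝ)}

/-- The payoffs of the actions against the sequence `y`. -/
def payoff (A : Finset (Fin d → ℝ)) (y : ℕ → Fin d → ℝ) (t : ℕ) (x : A) : ℝ :=
  (x : Fin d → ℝ) ⬝ᵥ y t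

/-- The memory of the algorithm after the given actions have been drawn. -/
noncomputable def stateOf (π : stdSimplex ℝ A) (γ : ℕ → Set.Icc (0 : ℝ) 1)
    (y : ℕ → Fin d → ℝ) (T : ℕ) (X : Fin T → A) : State A :=
  stateAfter π γ T fun s => (X s, payoff A y s (X s))

/-- The expectation over the first `T` actions of the algorithm. -/
noncomputable def expectPath (π : stdSimplex ℝ A) (γ : ℕ → Set.Icc (0 : ℝ) 1)
    (y : ℕ → Fin d → ℝ) (T : ℕ) (F : (Fin T → A) → ℝ) : ℝ :=
  expect (actionLaw (adaHedge π γ) (payoff A y) T) F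

theorem stateOf_snoc (π : stdSimplex ℝ A) (γ : ℕ → Set.Icc (0 : ℝ) 1)
    (y : ℕ → Fin d → ℝ) (T : ℕ) (X : Fin T → A) (a : A) :
    stateOf π γ y (T + 1) (Fin.snoc X a : Fin (T + 1) → A) =
      (stateOf π γ y T X).update π (γ T) a ((a : Fin d → ℝ) ⬝ᵥ y T) := by
  simp only [stateOf, stateAfter, Fin.snoc_last, Fin.val_last, payoff]
  congr 2
  funext s
  simp [Fin.init]

theorem expectPath_zero (π : stdSimplex ℝ A) (γ : ℕ → Set.Icc (0 : ℝ) 1)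
    (y : ℕ → Fin d → ℝ) (F : (Fin 0 → A) → ℝ) :
    expectPath π γ y 0 F = F Fin.elim0 := by
  classical
  rw [expectPath, actionLaw, expect_pure]

theorem expectPath_succ (π : stdSimplex ℝ A) (γ : ℕ → Set.Icc (0 : ℝ) 1)
    (y : ℕ → Fin d → ℝ) (T : ℕ) (F : (Fin (T + 1) → A) → ℝ) :
    expectPath π γ y (T + 1) F = expectPath π γ y T fun X =>
      ∑ a, (stateOf π γ y T X).p π (γ T) a * F (Fin.snoc X a : Fin (T + 1) → A) := by
  rw [expectPath, expect_actionLaw_succ]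
  simp only [adaHedge, expect_toPMF]
  rfl

theorem sum_p_mul_add (π : stdSimplex ℝ A) (γ : Set.Icc (0 : ℝ) 1) (S : State A) (c : ℝ)
    (f : A → ℝ) : ∑ a, S.p π γ a * (c + f a) = c + ∑ a, S.p π γ a * f a := by
  simp only [mul_add, Finset.sum_add_distrib, ← Finset.sum_mul, (State.p_mem π γ S).2, one_mul]

/-- The induction step of both telescoping arguments: `f` bounds the increment and `c` its
conditional mean. -/
theorem expectPath_succ_le {π : stdSimplex ℝ A} {γ : ℕ → Set.Icc (0 : ℝ) 1}
    {y : ℕ → Fin d → ℝ} {T : ℕ} {F : (Fin (T + 1) → A) → ℝ} {G : (Fin T → A) → ℝ}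
    (f : (Fin T → A) → A → ℝ) {c : ℝ}
    (h : ∀ X a, F (Fin.snoc X a : Fin (T + 1) → A) ≤ G X + f X a)
    (hf : ∀ X, ∑ a, (stateOf π γ y T X).p π (γ T) a * f X a ≤ c) :
    expectPath π γ y (T + 1) F ≤ expectPath π γ y T G + c := by
  rw [expectPath_succ, ← expect_const (actionLaw (adaHedge π γ) (payoff A y) T) c, expectPath,
    expectPath, ← expect_add]
  refine expect_mono _ fun X => ?_
  calc _ ≤ ∑ a, (stateOf π γ y T X).p π (γ T) a * (G X + f X a) :=
        Finset.sum_le_sum fun a _ => mul_le_mul_of_nonneg_left (h X a) ((State.p_mem π _ _).1 a)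
    _ ≤ _ := by
        rw [sum_p_mul_add]
        exact add_le_add_right (hf X) _

theorem regret_eq (σ : Strategy A) (y : ℕ → Fin d → ℝ) (T : ℕ) :
    regret σ y T = (⨆ x : A, ∑ t : Fin T, (x : Fin d → ℝ) ⬝ᵥ y t) -
      expect (actionLaw σ (payoff A y) T) fun X => ∑ t : Fin T, (X t : Fin d → ℝ) ⬝ᵥ y t := by
  rw [regret, PMF.integral_eq_sum]
  rfl

variable [Nonempty A] {π : stdSimplex ℝ A} {γ : ℕ → Set.Icc (0 : ℝ) 1} {y : ℕ → Fin d → ℝ}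

theorem expectPath_cumEst (hπ : IsOptimalDesign π) (hγ : ∀ t, 0 < (γ t : ℝ)) (T : ℕ) (x : A) :
    expectPath π γ y T (fun X => (stateOf π γ y T X).cumEst x) =
      ∑ t : Fin T, (x : Fin d → ℝ) ⬝ᵥ y t := by
  induction T with
  | zero => rw [expectPath_zero]; rfl
  | succ T ih =>
    rw [expectPath_succ, Fin.sum_univ_castSucc]
    simp only [Fin.val_castSucc, Fin.val_last]
    rw [← ih, ← expect_const (actionLaw (adaHedge π γ) (payoff A y) T) ((x : Fin d → ℝ) ⬝ᵥ y T),
      expectPath, expectPath, ← expect_add]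
    congr 1
    funext X
    rw [← (stateOf π γ y T X).sum_p_mul_est hπ (hγ T) (y T) x, ← sum_p_mul_add]
    refine Finset.sum_congr rfl fun a _ => ?_
    rw [stateOf_snoc]
    rfl

theorem stateOf_cumGap_nonneg (hK : 1 < Fintype.card A) (T : ℕ) (X : Fin T → A) :
    0 ≤ (stateOf π γ y T X).cumGap :=
  stateAfter_cumGap_nonneg hK _ _ _ _

theorem expectPath_pot_le (hK : 1 < Fintype.card A) (hπ : IsOptimalDesign π)
    (hγ : ∀ t, 0 < (γ t : ℝ)) {m M : ℝ}
    (hy : ∀ t, ∀ a : A, (a : Fin d → ℝ) ⬝ᵥ y t ∈ Set.Icc m M) (T : ℕ) :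
    expectPath π γ y T (fun X => (stateOf π γ y T X).pot - (stateOf π γ y T X).cumGap -
      ∑ t : Fin T, (X t : Fin d → ℝ) ⬝ᵥ y t) ≤ (M - m) * ∑ t ∈ Finset.range T, (γ t : ℝ) := by
  induction T with
  | zero =>
    rw [expectPath_zero]
    simp [stateOf, stateAfter, State.pot, State.rate, potential]
  | succ T ih =>
    rw [Finset.sum_range_succ, mul_add]
    refine (expectPath_succ_le (G := fun X => (stateOf π γ y T X).pot -
      (stateOf π γ y T X).cumGap - ∑ t : Fin T, (X t : Fin d → ℝ) ⬝ᵥ y t)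
      (c := (M - m) * γ T) (fun X a => ∑ x, (stateOf π γ y T X).q x *
        (stateOf π γ y T X).est π (γ T) a (y T) x - (a : Fin d → ℝ) ⬝ᵥ y T) ?_ ?_).trans
      (add_le_add_left ih _)
    · intro X a
      have h := State.pot_update_le hK (stateOf_cumGap_nonneg (y := y) (π := π) (γ := γ) hK T X)
        π (γ T) a (y T)
      rw [stateOf_snoc, Fin.sum_univ_castSucc]
      simp only [Fin.snoc_castSucc, Fin.snoc_last, Fin.val_castSucc, Fin.val_last]
      linarith
    · intro X
      simp only [mul_sub, Finset.sum_sub_distrib]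
      rw [State.sum_p_mul_sum_q_mul_est hπ _ (hγ T)]
      exact State.sum_q_sub_sum_p_le π _ (γ T) (hy T)

theorem expectPath_sq_cumGap_le (hK : 1 < Fintype.card A) (hπ : IsOptimalDesign π)
    (hγ : ∀ t, 0 < (γ t : ℝ)) (hγ' : ∀ t, (γ t : ℝ) ≤ 1 / 2) {B : ℝ}
    (hy : ∀ t, ∀ a : A, |(a : Fin d → ℝ) ⬝ᵥ y t| ≤ B) {s : ℝ} (T : ℕ)
    (hs : ∀ t < T, 2 * (B * (d / γ t)) ≤ s) :
    expectPath π γ y T (fun X => (stateOf π γ y T X).cumGap ^ 2 -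
      (2 / 3 * Real.log (Fintype.card A) + 1) * s * (stateOf π γ y T X).cumGap) ≤
        T * (Real.log (Fintype.card A) * (2 * d * B ^ 2)) := by
  have hL : 0 < Real.log (Fintype.card A) := Real.log_pos (by exact_mod_cast hK)
  induction T with
  | zero =>
    rw [expectPath_zero]
    simp [stateOf, stateAfter]
  | succ T ih =>
    push_cast
    rw [add_mul (T : ℝ) 1, one_mul]
    refine (expectPath_succ_le (G := fun X => (stateOf π γ y T X).cumGap ^ 2 -
      (2 / 3 * Real.log (Fintype.card A) + 1) * s * (stateOf π γ y T X).cumGap)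
      (c := Real.log (Fintype.card A) * (2 * d * B ^ 2))
      (fun X a => Real.log (Fintype.card A) * ∑ x, (stateOf π γ y T X).q x *
        (stateOf π γ y T X).est π (γ T) a (y T) x ^ 2) ?_ ?_).trans
      (add_le_add_left (ih fun t ht => hs t (ht.trans T.lt_succ_self)) _)
    · intro X a
      rw [stateOf_snoc]
      refine State.sq_cumGap_update_le hK (stateOf_cumGap_nonneg hK T X) π (γ T) a (y T)
        fun x x' => ?_
      have h1 := abs_le.1 ((stateOf π γ y T X).abs_est_le hπ (hγ T) (hy T) a x)
      have h2 := abs_le.1 ((stateOf π γ y T X).abs_est_le hπ (hγ T) (hy T) a x')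
      linarith [hs T T.lt_succ_self]
    · intro X
      simp only [mul_left_comm _ (Real.log (Fintype.card A)), ← Finset.mul_sum]
      exact mul_le_mul_of_nonneg_left
        (State.sum_p_mul_sum_q_mul_est_sq_le hπ _ (hγ T) (hγ' T) (hy T)) hL.le

/-- The comparator is fixed before the expectation is taken, so unbiasedness suffices. One Δ comes
from the growth of the potential, the other from the overhead (ln K)/η. -/
theorem regret_adaHedge_le (hK : 1 < Fintype.card A) (hπ : IsOptimalDesign π)
    (hγ : ∀ t, 0 < (γ t : ℝ)) {m M : ℝ}
    (hy : ∀ t, ∀ a : A, (a : Fin d → ℝ) ⬝ᵥ y t ∈ Set.Icc m M) (T : ℕ) :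
    regret (adaHedge π γ) y T ≤ (M - m) * ∑ t ∈ Finset.range T, (γ t : ℝ) +
      2 * expectPath π γ y T fun X => (stateOf π γ y T X).cumGap := by
  have h := expectPath_pot_le hK hπ hγ hy T
  rw [regret_eq, sub_le_iff_le_add]
  refine ciSup_le fun x => ?_
  rw [← expectPath_cumEst hπ hγ T x]
  have h2 : expectPath π γ y T (fun X => (stateOf π γ y T X).cumEst x) ≤
      expectPath π γ y T fun X => (stateOf π γ y T X).pot + (stateOf π γ y T X).cumGap :=
    expect_mono _ fun X => State.cumEst_le_pot_add hK (stateOf_cumGap_nonneg hK T X) x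
  simp only [expectPath, expect_add, expect_sub] at h h2 ⊢
  linarith

/-- The solution of a quadratic inequality. -/
theorem le_add_of_sq_le {D b c : ℝ} (hb : 0 ≤ b) (hc : 0 ≤ c) (h : D ^ 2 - b * D ≤ c ^ 2) :
    D ≤ b + c := by
  by_contra! hlt
  nlinarith

theorem expectPath_cumGap_le (hK : 1 < Fintype.card A) (hπ : IsOptimalDesign π)
    (hγ : ∀ t, 0 < (γ t : ℝ)) (hγ' : ∀ t, (γ t : ℝ) ≤ 1 / 2) {B : ℝ}
    (hy : ∀ t, ∀ a : A, |(a : Fin d → ℝ) ⬝ᵥ y t| ≤ B) {s : ℝ} (hs0 : 0 ≤ s) (T : ℕ)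
    (hs : ∀ t < T, 2 * (B * (d / γ t)) ≤ s) :
    expectPath π γ y T (fun X => (stateOf π γ y T X).cumGap) ≤
      (2 / 3 * Real.log (Fintype.card A) + 1) * s +
        3 / 2 * (B * Real.sqrt (d * T * Real.log (Fintype.card A))) := by
  have hL : 0 < Real.log (Fintype.card A) := Real.log_pos (by exact_mod_cast hK)
  have hB : 0 ≤ B := by
    obtain ⟨a⟩ := ‹Nonempty A›
    exact (abs_nonneg _).trans (hy 0 a)
  -- The factor 3/2 is a rational bound for √2: (3/2)² ≥ 2.
  refine le_add_of_sq_le (by positivity) (by positivity) ?_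
  have h1 := expectPath_sq_cumGap_le hK hπ hγ hγ' hy T hs
  have h2 := sq_expect_le (actionLaw (adaHedge π γ) (payoff A y) T)
    fun X => (stateOf π γ y T X).cumGap
  have h3 : Real.sqrt (d * T * Real.log (Fintype.card A)) ^ 2 =
      d * T * Real.log (Fintype.card A) := Real.sq_sqrt (by positivity)
  have h4 : 0 ≤ d * T * Real.log (Fintype.card A) * B ^ 2 := by positivity
  rw [mul_pow, mul_pow, h3]
  simp only [expectPath, expect_sub, expect_const_mul] at h1 ⊢
  linarith

end Regret

/-! ### Numerical estimates for the exploration rates. -/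

section Rates

theorem sum_inv_sqrt_le (T : ℕ) :
    ∑ t ∈ Finset.range T, 1 / Real.sqrt ((t : ℝ) + 1) ≤ 2 * Real.sqrt T := by
  induction T with
  | zero => simp
  | succ T ih =>
    rw [Finset.sum_range_succ]
    push_cast
    refine (add_le_add_left ih _).trans ?_
    have h1 : 0 < Real.sqrt ((T : ℝ) + 1) := Real.sqrt_pos.2 (by positivity)
    have h2 := Real.sq_sqrt (show (0 : ℝ) ≤ T + 1 by positivity)
    have h3 := Real.sq_sqrt (show (0 : ℝ) ≤ T by positivity)
    rw [← le_sub_iff_add_le', div_le_iff₀ h1]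
    nlinarith [sq_nonneg (Real.sqrt ((T : ℝ) + 1) - Real.sqrt T)]

theorem sum_explorationRate_le (d K T : ℕ) :
    ∑ t ∈ Finset.range T, (explorationRate d K t : ℝ) ≤
      3.2 * Real.sqrt (d * T * Real.log K) := by
  have hL : 0 ≤ Real.log K := Real.log_natCast_nonneg K
  calc ∑ t ∈ Finset.range T, (explorationRate d K t : ℝ)
      ≤ ∑ t ∈ Finset.range T, Real.sqrt (2.5 * d * Real.log K) *
          (1 / Real.sqrt ((t : ℝ) + 1)) := by
        refine Finset.sum_le_sum fun t _ => (min_le_right _ _).trans (le_of_eq ?_)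
        rw [Real.sqrt_div' _ (by positivity)]
        ring
    _ ≤ Real.sqrt (2.5 * d * Real.log K) * (2 * Real.sqrt T) := by
        rw [← Finset.mul_sum]
        exact mul_le_mul_of_nonneg_left (sum_inv_sqrt_le T) (Real.sqrt_nonneg _)
    _ = 2 * Real.sqrt 2.5 * Real.sqrt (d * T * Real.log K) := by
        rw [show (d : ℝ) * T * Real.log K = (d * Real.log K) * T by ring, mul_assoc (2.5 : ℝ),
          Real.sqrt_mul (by norm_num) (d * Real.log K),
          Real.sqrt_mul (by positivity) (T : ℝ)]
        ring
    _ ≤ _ := by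
        refine mul_le_mul_of_nonneg_right ?_ (Real.sqrt_nonneg _)
        have : Real.sqrt 2.5 ≤ 1.6 := Real.sqrt_le_iff.2 (by norm_num)
        linarith

theorem explorationRate_pos {d K : ℕ} (hd : 0 < d) (hK : 1 < K) (t : ℕ) :
    0 < (explorationRate d K t : ℝ) := by
  have hL : 0 < Real.log K := Real.log_pos (by exact_mod_cast hK)
  have hd' : (0 : ℝ) < d := by exact_mod_cast hd
  exact lt_min (by norm_num) (Real.sqrt_pos.2 (by positivity))

/-- The two summands cover the two branches of the minimum; 0.64 exceeds 1/√2.5. -/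
theorem div_explorationRate_le {d K : ℕ} (hd : 0 < d) (hK : 1 < K) {t T : ℕ} (h : t < T) :
    Real.log K * (d / (explorationRate d K t : ℝ)) ≤
      2 * (d * Real.log K) + 0.64 * Real.sqrt (d * T * Real.log K) := by
  have hL : 0 < Real.log K := Real.log_pos (by exact_mod_cast hK)
  have hd' : (0 : ℝ) < d := by exact_mod_cast hd
  have h0 := Real.sqrt_nonneg (d * T * Real.log K)
  rw [← mul_div_assoc, div_le_iff₀ (explorationRate_pos hd hK t)]
  change _ ≤ _ * min (1 / 2 : ℝ) _
  rcases min_cases (1 / 2 : ℝ) (Real.sqrt (2.5 * d * Real.log K / ((t : ℝ) + 1))) with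
    ⟨h1, -⟩ | ⟨h1, -⟩
  · rw [h1]
    linarith
  · rw [h1]
    have hT : (t : ℝ) + 1 ≤ T := by exact_mod_cast h
    have h2 : (d * Real.log K) ≤ 0.64 * Real.sqrt (d * T * Real.log K) *
        Real.sqrt (2.5 * d * Real.log K / ((t : ℝ) + 1)) := by
      rw [mul_assoc, ← Real.sqrt_mul (by positivity), ← div_le_iff₀' (by norm_num)]
      refine Real.le_sqrt_of_sq_le ?_
      rw [mul_div_assoc', le_div_iff₀ (by positivity)]
      have h3 : (d * Real.log K) ^ 2 * ((t : ℝ) + 1) ≤ (d * Real.log K) ^ 2 * T :=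
        mul_le_mul_of_nonneg_left hT (by positivity)
      have h4 : 0 ≤ (d * Real.log K) ^ 2 * T := by positivity
      rw [div_pow, div_mul_eq_mul_div, div_le_iff₀ (by norm_num)]
      nlinarith
    have h5 : 0 ≤ 2 * (d * Real.log K) *
        Real.sqrt (2.5 * d * Real.log K / ((t : ℝ) + 1)) := by positivity
    linarith

end Rates

/-! ### Assembly of the final bound. -/

variable {d : ℕ} {A : Finset (Fin d → ℝ)}

theorem regret_of_subsingleton [Nonempty A] [Subsingleton A] (σ : Strategy A)
    (y : ℕ → Fin d → ℝ) (T : ℕ) : regret σ y T = 0 := by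
  obtain ⟨a⟩ := ‹Nonempty A›
  have h : (fun X : Fin T → A => ∑ t : Fin T, (X t : Fin d → ℝ) ⬝ᵥ y t) =
      fun _ => ∑ t : Fin T, (a : Fin d → ℝ) ⬝ᵥ y t := by
    funext X
    exact Finset.sum_congr rfl fun t _ => by rw [Subsingleton.elim (X t) a]
  have : Nonempty A := ⟨a⟩
  have h2 : (fun x : A => ∑ t : Fin T, (x : Fin d → ℝ) ⬝ᵥ y t) =
      fun _ => ∑ t : Fin T, (a : Fin d → ℝ) ⬝ᵥ y t := by
    funext x
    rw [Subsingleton.elim x a]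
  rw [regret_eq, h, h2, expect_const, ciSup_const, sub_self]

theorem regret_adaHedge_explorationRate_le (hd : 0 < d) (hK : 1 < A.card)
    {π : stdSimplex ℝ A} (hπ : IsOptimalDesign π) {m M : ℝ} (hm : m ≤ 0) (hM : 0 ≤ M)
    {y : ℕ → Fin d → ℝ} (hy : ∀ t, ∀ a : A, (a : Fin d → ℝ) ⬝ᵥ y t ∈ Set.Icc m M) (T : ℕ) :
    regret (adaHedge π (explorationRate d A.card)) y T ≤
      12 * (M - m) * Real.sqrt (d * T * Real.log A.card) +
        18 * (M - m) * d * Real.log A.card := by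
  have hcard : Fintype.card A = A.card := Fintype.card_coe A
  have hK' : 1 < Fintype.card A := hcard ▸ hK
  have : Nonempty A := (Finset.card_pos.1 (zero_lt_one.trans hK)).to_subtype
  have hB : 0 ≤ M - m := by linarith
  have hγ := explorationRate_pos (d := d) hd hK
  -- The signs m ≤ 0 ≤ M let the payoff range also bound absolute payoffs.
  have habs : ∀ t, ∀ a : A, |(a : Fin d → ℝ) ⬝ᵥ y t| ≤ M - m := fun t a =>
    abs_le.2 ⟨by linarith [(hy t a).1], by linarith [(hy t a).2]⟩
  have hlog2 : Real.log 2 ≤ Real.log A.card :=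
    Real.log_le_log (by norm_num) (by exact_mod_cast hK)
  have hL1 : 1 ≤ 1.45 * Real.log A.card := by
    have := Real.log_two_gt_d9
    linarith
  have hL : 0 < Real.log A.card := by linarith
  set L := Real.log A.card with hLdef
  set Q := Real.sqrt (d * T * L) with hQ
  have hQ0 : 0 ≤ Q := Real.sqrt_nonneg _
  set s := 2 * (M - m) * (2 * (d * L) + 0.64 * Q) / L with hs
  have hs0 : 0 ≤ s := by positivity
  have hsL : L * s = 2 * (M - m) * (2 * (d * L) + 0.64 * Q) := mul_div_cancel₀ _ hL.ne'
  have h1 := regret_adaHedge_le hK' hπ hγ hy T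
  have h2 := expectPath_cumGap_le hK' hπ hγ (fun t => min_le_left _ _) habs hs0 T fun t ht => by
    rw [hs, le_div_iff₀ hL]
    have := mul_le_mul_of_nonneg_left (div_explorationRate_le hd hK ht)
      (mul_nonneg zero_le_two hB)
    linarith
  rw [hcard, ← hLdef, ← hQ] at h2
  have h3 := mul_le_mul_of_nonneg_left (sum_explorationRate_le d A.card T) hB
  rw [← hLdef, ← hQ] at h3
  -- 2/3 + 1.45 < 2.12, where 1 ≤ 1.45 L comes from K ≥ 2.
  have h4 : (2 / 3 * L + 1) * s ≤ 2.12 * (L * s) := by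
    nlinarith [mul_le_mul_of_nonneg_right hL1 hs0]
  rw [hsL] at h4
  have h5 : 0 ≤ (M - m) * Q := mul_nonneg hB hQ0
  have h6 : 0 ≤ (M - m) * (d * L) := by positivity
  -- In units of M - m, the coefficient of Q is 3.2 + 4·2.12·0.64 + 3 < 12 and that of dL is 8·2.12
  -- < 18.
  nlinarith

end LinearBandit

theorem mainTheorem7 (d : ℕ) (A : Finset (Fin d → ℝ)) (hA : A.Nonempty)
    (hspan : Submodule.span ℝ (A : Set (Fin d → ℝ)) = ⊤) :
    (∃ π : stdSimplex ℝ A, LinearBandit.IsOptimalDesign π) ∧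
    ∀ π : stdSimplex ℝ A, LinearBandit.IsOptimalDesign π →
      ∀ m M : ℝ, m ≤ 0 → 0 ≤ M →
      ∀ y : ℕ → Fin d → ℝ, (∀ t, ∀ x ∈ A, x ⬝ᵥ y t ∈ Set.Icc m M) →
      ∀ T : ℕ,
        LinearBandit.regret
            (LinearBandit.adaHedge π (LinearBandit.explorationRate d A.card)) y T ≤
          12 * (M - m) * Real.sqrt (d * T * Real.log A.card) +
            18 * (M - m) * d * Real.log A.card := by
  refine ⟨LinearBandit.exists_isOptimalDesign hA hspan, fun π hπ m M hm hM y hy T => ?_⟩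
  have hne : Nonempty A := hA.to_subtype
  rcases Nat.lt_or_ge 1 A.card with hK | hK
  · have hd : 0 < d := by
      rcases Nat.eq_zero_or_pos d with rfl | hd
      · exact absurd (Finset.card_le_one_of_subsingleton A) hK.not_ge
      · exact hd
    exact LinearBandit.regret_adaHedge_explorationRate_le hd hK hπ hm hM
      (fun t a => hy t a a.2) T
  -- With a single action ln K = 0 and the exploration rates vanish, but the regret is zero for any
  -- strategy.
  · have : Subsingleton A := Finset.card_le_one_iff_subsingleton_coe.1 hK
    rw [LinearBandit.regret_of_subsingleton]
    have hB : 0 ≤ M - m := by linarith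
    have hL : 0 ≤ Real.log A.card := Real.log_natCast_nonneg _
    positivity
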